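/- **Spaces.** Let $\Omega\subset\mathbb R^d$ be a bounded Lipschitz domain, $T>0$, $\kappa\in\mathbb N_0$, $1\le\hat q\le\hat p<\infty$, $1<p<\infty$, $1\le q\le p$, $1\le r<\infty$. Let $V,\tilde V,W,V_1,\dots,V_\kappa$ be reflexive, separable real Banach spaces and $Y$ a real Banach space, with embeddings (continuous injections, compatible with each other as inclusions of function spaces) $$V\hookrightarrow\tilde V\hookrightarrow W,\quad V\hookrightarrow W^{\kappa,\hat p}(\Omega)\text{ compactly},\quad V\hookrightarrow Y,\quad L^{\hat q}(\Omega)\hookrightarrow W,\quad L^{\hat p}(\Omega)\hookrightarrow V_k\hookrightarrow L^{\hat q}(\Omega)\ (1\le k\le\kappa),$$ and either $W^{\kappa,\hat p}(\Omega)\hookrightarrow\tilde V$ or $\tilde V\hookrightarrow W^{\kappa,\hat p}(\Omega)$. Put $\mathcal V=\{u\in L^p(0,T;V):\partial_tu\in L^p(0,T;\tilde V)\}$ (weak time derivative), with any norm $\|\cdot\|_{\mathcal V}$ equivalent to $\|u\|_{L^p(0,T;V)}+\|\partial_tu\|_{L^p(0,T;\tilde V)}$, and $\mathcal W=L^q(0,T;W)$,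 $\mathcal Y=L^r(0,T;Y)$. Let $\mathcal J_\kappa v=(D^\beta v)_{|\beta|\le\kappa}$ (weak derivatives in space) and assume that for some $c_{\mathcal V}>0$, $\|\mathcal J_\kappa v\|_{L^\infty((0,T)\times\Omega)}\le c_{\mathcal V}\|v\|_{\mathcal V}$ for all $v\in\mathcal V$. **Networks.** Fix a depth $L\ge1$, widths $n^\sigma_0,\dots,n^\sigma_L$, $n^r_1,\dots,n^r_L$, degrees $d_1,\dots,d_{L+1}$ and base functions $\sigma_i:\mathbb R^{n^r_i}\to\mathbb R^{n^\sigma_i}$, i.e. continuous functions that are not rational (rational: every component is a quotient of coprime polynomials with everywhere positive denominator). For $\theta\in\Theta$ let $$\mathfrak S^\theta(x)=r_{L+1}\big((\sigma_L\circ r_L\circ\cdots\circ\sigma_1\circ r_1)(x),x\big),\qquad x\in\mathbb R^{n^\sigma_0},$$ where every component of $r_i$ is a quotient of two polynomials of degree at most $d_i$ ($r_{L+1}$ is scalar), $\theta$ is the vector of all their coefficients, and $\Theta$ is the set of those $\theta$ for which every denominator polynomial is $\ge\varepsilon$ everywhere and has a coefficient vector of Euclidean norm $1$, for a fixed $\varepsilon>0$.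 The inputs of the network are the entries of $\mathcal J_\kappa u(t,x)$, and optionally also the time $t$; $\mathfrak S^\theta(\mathcal J_\kappa u)$ denotes the resulting function of $(t,x)$, regarded as an element of $\mathcal W$. **Measurements and regularization.** Let $K^\dagger:\mathcal V\to\mathcal Y$ be injective and weak-strong continuous, let $K^m:\mathcal V\to\mathcal Y$, $m\in\mathbb N$, be weak-weak continuous, and let $K^mv^m-K^\dagger v^m\to0$ in $\mathcal Y$ for every weakly convergent sequence $(v^m)_m\subset\mathcal V$. Let $u^\dagger\in\mathcal V$, $y^\dagger=K^\dagger u^\dagger$, and let $y^m\in\mathcal Y$ satisfy $\|y^m-K^mu^\dagger\|_{\mathcal Y}^r\le\delta(m)$ with $\delta(m)\ge0$, $\delta(m)\to0$. Let $\mathcal R(u,\theta)=\|u\|_{\mathcal V}^p+\mathcal R_0(\theta)$ with $\mathcal R_0:\Theta\to[0,\infty]$ proper, coercive and lower semicontinuous. Assume that the law is representable: there is $\theta^\dagger\in\Theta$ with $\mathcal R_0(\theta^\dagger)<\infty$ and $\partial_tu^\dagger=\mathfrak S^{\theta^\dagger}(\mathcal J_\kappa u^\dagger)$. **Theorem.**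 For $m\in\mathbb N$ let $\lambda^m,\mu^m>0$ and let $(u^m,\theta^m)\in\mathcal V\times\Theta$ minimize $$(u,\theta)\mapsto\lambda^m\|\partial_tu-\mathfrak S^\theta(\mathcal J_\kappa u)\|_{\mathcal W}^q+\mu^m\|K^mu-y^m\|_{\mathcal Y}^r+\mathcal R(u,\theta)\tag{$\mathcal P^m$}$$ over $\mathcal V\times\Theta$, where $\lambda^m\to\infty$, $\mu^m\to\infty$ and $\mu^m\delta(m)\to0$. Then $u^m\rightharpoonup u^\dagger$ weakly in $\mathcal V$; the sequence $(\theta^m)_m$ has a subsequence converging to an element of $\Theta$; and for every convergent subsequence $\theta^{m_l}\to\tilde\theta\in\Theta$: 1. $\partial_tu^\dagger=\mathfrak S^{\tilde\theta}(\mathcal J_\kappa u^\dagger)$; 2. $\mathfrak S^{\theta^{m_l}}\to\mathfrak S^{\tilde\theta}$ in $L^\infty_{\mathrm{loc}}(\mathbb R^{n^\sigma_0})$ as $l\to\infty$; 3. $\mathcal R(u^\dagger,\tilde\theta)\le\mathcal R(u^\dagger,\theta)$ for every $\theta\in\Theta$ with $\partial_tu^\dagger=\mathfrak S^{\theta}(\mathcal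 J_\kappa u^\dagger)$. -/

import Mathlib

open MeasureTheory Filter Topology Set
open scoped ENNReal ContDiff

noncomputable section

namespace SymNet

/-! ### Multi-indices, rational functions and symbolic networks -/

/-- Multi-indices `k ∈ ℕ₀ⁿ` with `k₁ + ⋯ + kₙ ≤ d`. There are `(n + d).choose d` of them. -/
abbrev MultiIdx (n d : ℕ) : Type := {k : Fin n → Fin (d + 1) // ∑ i, (k i : ℕ) ≤ d}

/-- The zero multi-index. -/
def MultiIdx.zero (n d : ℕ) : MultiIdx n d := ⟨fun _ => 0, by simp⟩

/-- The order `|k| = k₁ + ⋯ + kₙ` of a multi-index. -/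
def MultiIdx.order {n d : ℕ} (k : MultiIdx n d) : ℕ := ∑ i, (k.1 i : ℕ)

/-- Coefficient vectors of polynomials of degree at most `d` in `n` variables, with the Euclidean
norm. -/
abbrev Coeff (n d : ℕ) : Type := EuclideanSpace ℝ (MultiIdx n d)

/-- The polynomial with coefficient vector `a`, evaluated at `x`. -/
def polyEval {n d : ℕ} (a : Coeff n d) (x : Fin n → ℝ) : ℝ :=
  ∑ k : MultiIdx n d, a k * ∏ l, x l ^ (k.1 l : ℕ)

/-- Normalised coefficient vectors of polynomials that are bounded below by `ε` on `ℝⁿ`. -/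
def normalizedDenominators (ε : ℝ) (n d : ℕ) : Set (Coeff n d) :=
  {b | (∀ x : Fin n → ℝ, ε ≤ polyEval b x) ∧ ‖b‖ = 1}

/-- A function `ℝⁿ → ℝᵐ` is rational if every component is a quotient `p / q` of coprime
polynomials with `q > 0` on `ℝⁿ`. -/
def IsRational {n m : ℕ} (f : (Fin n → ℝ) → (Fin m → ℝ)) : Prop :=
  ∀ i : Fin m, ∃ p q : MvPolynomial (Fin n) ℝ, IsRelPrime p q ∧
    (∀ x, 0 < MvPolynomial.eval x q) ∧
    ∀ x, f x i = MvPolynomial.eval x p / MvPolynomial.eval x q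

/-- Base functions: continuous functions that are not rational. -/
def IsBaseFunction {n m : ℕ} (f : (Fin n → ℝ) → (Fin m → ℝ)) : Prop :=
  Continuous f ∧ ¬ IsRational f

/-- A fixed network architecture of depth `L`. The `i`-th hidden layer, `i < L`, consists of a
rational transformation `ℝ^(width i) → ℝ^(rwidth i)` of degree at most `degree i` followed by the
activation `act i : ℝ^(rwidth i) → ℝ^(width (i + 1))`; the output layer is a rational function
`ℝ^(width L + width 0) → ℝ` of degree at most `degree L`. Values of the sequences at other
indices are irrelevant. -/
structure Architecture where
  /-- depth -/
  L : ℕ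
  depth_pos : 0 < L
  /-- dimensions of the input (index `0`) and of the activated layers -/
  width : ℕ → ℕ
  /-- dimensions of the values of the rational transformations -/
  rwidth : ℕ → ℕ
  /-- degrees of the rational transformations -/
  degree : ℕ → ℕ
  /-- activation functions -/
  act : (i : ℕ) → (Fin (rwidth i) → ℝ) → (Fin (width (i + 1)) → ℝ)
  act_base : ∀ i < L, IsBaseFunction (act i)

namespace Architecture

variable (A : Architecture)

/-- All coefficients of the network: for every component of every rational transformation the pair
(numerator coefficients, denominator coefficients). The second factor belongs to the output
layer. -/
abbrev Coeffs : Type :=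
  ((i : Fin A.L) → Fin (A.rwidth i) → Coeff (A.width i) (A.degree i) × Coeff (A.width i) (A.degree i))
    × (Coeff (A.width A.L + A.width 0) (A.degree A.L) ×
        Coeff (A.width A.L + A.width 0) (A.degree A.L))

/-- The parameter set: numerator coefficients are free, denominator coefficients are normalised
and belong to polynomials that are bounded below by `ε`. -/
def paramSet (ε : ℝ) : Set A.Coeffs :=
  {θ | (∀ (i : Fin A.L) (k : Fin (A.rwidth i)),
          (θ.1 i k).2 ∈ normalizedDenominators ε (A.width i) (A.degree i)) ∧
        θ.2.2 ∈ normalizedDenominators ε (A.width A.L + A.width 0) (A.degree A.L)}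

/-- The composition of the first `i` hidden layers. -/
def hidden (θ : A.Coeffs) (x : Fin (A.width 0) → ℝ) :
    (i : ℕ) → i ≤ A.L → (Fin (A.width i) → ℝ)
  | 0, _ => x
  | i + 1, h => A.act i fun k =>
      polyEval (θ.1 ⟨i, h⟩ k).1 (hidden θ x i (Nat.le_of_succ_le h)) /
        polyEval (θ.1 ⟨i, h⟩ k).2 (hidden θ x i (Nat.le_of_succ_le h))

/-- The function `ℝ^(width 0) → ℝ` computed by the network with parameters `θ`: the hidden layers,
followed by a rational output layer with skip connection. -/
def eval (θ : A.Coeffs) (x : Fin (A.width 0) → ℝ) : ℝ :=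
  polyEval θ.2.1 (Fin.append (A.hidden θ x A.L le_rfl) x) /
    polyEval θ.2.2 (Fin.append (A.hidden θ x A.L le_rfl) x)

end Architecture

/-! ### Domains and Sobolev spaces -/

/-- Bounded Lipschitz domains: bounded, open, connected, non-empty sets that are near every boundary
point, in suitable orthogonal coordinates, the strict epigraph of a Lipschitz function of the
coordinates orthogonal to a unit vector `ν`. -/
structure IsBoundedLipschitzDomain {d : ℕ} (Ω : Set (EuclideanSpace ℝ (Fin d))) : Prop where
  isOpen : IsOpen Ω
  isConnected : IsConnected Ω
  isBounded : Bornology.IsBounded Ω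
  lipschitz_boundary : ∀ x₀ ∈ frontier Ω, ∃ U ∈ 𝓝 x₀, ∃ ν : EuclideanSpace ℝ (Fin d), ‖ν‖ = 1 ∧
    ∃ (C : NNReal) (g : EuclideanSpace ℝ (Fin d) → ℝ), LipschitzWith C g ∧
      (∀ (x : EuclideanSpace ℝ (Fin d)) (s : ℝ), g (x + s • ν) = g x) ∧
      ∀ x ∈ U, (x ∈ Ω ↔ g x < inner ℝ ν x)

/-- The `i`-th partial derivative. -/
def partialDeriv {d : ℕ} (i : Fin d) (φ : EuclideanSpace ℝ (Fin d) → ℝ) :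
    EuclideanSpace ℝ (Fin d) → ℝ :=
  fun x => fderiv ℝ φ x (EuclideanSpace.single i 1)

/-- The partial derivative `∂^β φ`. -/
def multiDeriv {d κ : ℕ} (β : MultiIdx d κ) (φ : EuclideanSpace ℝ (Fin d) → ℝ) :
    EuclideanSpace ℝ (Fin d) → ℝ :=
  (List.finRange d).foldr (fun i ψ => (partialDeriv i)^[(β.1 i : ℕ)] ψ) φ

/-- Test functions on a set `O`: smooth functions with compact support contained in `O`. -/
structure IsTestFunction {E : Type*} [NormedAddCommGroup E] [NormedSpace ℝ E] (O : Set E)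
    (φ : E → ℝ) : Prop where
  smooth : ContDiff ℝ ∞ φ
  hasCompactSupport : HasCompactSupport φ
  tsupport_subset : tsupport φ ⊆ O

theorem partialDeriv_good {d : ℕ} (i : Fin d) {φ : EuclideanSpace ℝ (Fin d) → ℝ}
    (h : ContDiff ℝ ∞ φ ∧ HasCompactSupport φ) :
    ContDiff ℝ ∞ (partialDeriv i φ) ∧ HasCompactSupport (partialDeriv i φ) := by
  refine ⟨?_, h.2.fderiv_apply ℝ _⟩
  have h1 : ContDiff ℝ ∞ (fderiv ℝ φ) := h.1.fderiv_right (by simp)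
  exact h1.clm_apply contDiff_const

theorem multiDeriv_good {d κ : ℕ} (β : MultiIdx d κ) {φ : EuclideanSpace ℝ (Fin d) → ℝ}
    (h : ContDiff ℝ ∞ φ ∧ HasCompactSupport φ) :
    ContDiff ℝ ∞ (multiDeriv β φ) ∧ HasCompactSupport (multiDeriv β φ) := by
  unfold multiDeriv
  induction List.finRange d with
  | nil => exact h
  | cons i l ih =>
    rw [List.foldr_cons]
    generalize (β.1 i : ℕ) = n
    induction n with
    | zero => exact ih
    | succ n ihn =>
      rw [Function.iterate_succ_apply']
      exact partialDeriv_good i ihn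

theorem integrable_test_mul {E F : Type*} [NormedAddCommGroup E] [MeasurableSpace E] [BorelSpace E]
    [NormedAddCommGroup F] [NormedSpace ℝ F]
    {μ : Measure E} [IsLocallyFiniteMeasure μ] {p : ℝ≥0∞} [hp : Fact (1 ≤ p)] (f : Lp F p μ)
    {φ : E → ℝ} (hc : Continuous φ) (hs : HasCompactSupport φ) :
    Integrable (fun x => φ x • f x) μ :=
  ((Lp.memLp f).locallyIntegrable hp.out).integrable_smul_left_of_hasCompactSupport hc hs

/-- The Sobolev space `W^{κ,p}(Ω)`: a function `v ∈ L^p(Ω)` together with its weak derivatives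
`D^β v ∈ L^p(Ω)`, `|β| ≤ κ`. An element is recorded as the family `(D^β v)_β`, which is determined by
`v = D^0 v`; the norm is `max_β ‖D^β v‖_{L^p}`. -/
def SobolevSpace {d : ℕ} (κ : ℕ) (p : ℝ≥0∞) [Fact (1 ≤ p)] (Ω : Set (EuclideanSpace ℝ (Fin d))) :
    Submodule ℝ (MultiIdx d κ → Lp ℝ p (volume.restrict Ω)) where
  carrier := {f | ∀ (β : MultiIdx d κ) (φ : EuclideanSpace ℝ (Fin d) → ℝ), IsTestFunction Ω φ →
    ∫ x in Ω, multiDeriv β φ x • f (MultiIdx.zero d κ) x =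
      (-1 : ℝ) ^ β.order * ∫ x in Ω, φ x • f β x}
  zero_mem' := by
    intro β φ _
    have h0 : ∀ ψ : EuclideanSpace ℝ (Fin d) → ℝ,
        ∫ x in Ω, ψ x • (0 : Lp ℝ p (volume.restrict Ω)) x = 0 := by
      intro ψ
      rw [← integral_zero (α := EuclideanSpace ℝ (Fin d)) (G := ℝ) (μ := volume.restrict Ω)]
      refine integral_congr_ae ?_
      filter_upwards [Lp.coeFn_zero ℝ p (volume.restrict Ω)] with x hx
      rw [hx]
      simp
    simp only [Pi.zero_apply, h0, mul_zero]
  add_mem' := by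
    intro f g hf hg β φ hφ
    have key : ∀ (ψ : EuclideanSpace ℝ (Fin d) → ℝ) (γ : MultiIdx d κ), Continuous ψ →
        HasCompactSupport ψ → ∫ x in Ω, ψ x • (f + g) γ x =
          (∫ x in Ω, ψ x • f γ x) + ∫ x in Ω, ψ x • g γ x := by
      intro ψ γ hc hs
      rw [← integral_add (integrable_test_mul (f γ) hc hs) (integrable_test_mul (g γ) hc hs)]
      refine integral_congr_ae ?_
      filter_upwards [Lp.coeFn_add (f γ) (g γ)] with x hx
      rw [Pi.add_apply, hx, Pi.add_apply, smul_add]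
    have hm := multiDeriv_good β ⟨hφ.smooth, hφ.hasCompactSupport⟩
    rw [key _ _ hm.1.continuous hm.2, key _ _ hφ.smooth.continuous hφ.hasCompactSupport,
      hf β φ hφ, hg β φ hφ, mul_add]
  smul_mem' := by
    intro c f hf β φ hφ
    have key : ∀ (ψ : EuclideanSpace ℝ (Fin d) → ℝ) (γ : MultiIdx d κ),
        ∫ x in Ω, ψ x • (c • f) γ x = c * ∫ x in Ω, ψ x • f γ x := by
      intro ψ γ
      rw [← integral_const_mul]
      refine integral_congr_ae ?_
      filter_upwards [Lp.coeFn_smul c (f γ)] with x hx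
      rw [Pi.smul_apply, hx, Pi.smul_apply]
      simp only [smul_eq_mul]
      ring
    rw [key, key, hf β φ hφ]
    ring

/-- The weak derivative `D^β v ∈ L^p(Ω)` of a Sobolev function. -/
def SobolevSpace.D {d κ : ℕ} {p : ℝ≥0∞} [Fact (1 ≤ p)] {Ω : Set (EuclideanSpace ℝ (Fin d))}
    (β : MultiIdx d κ) (v : SobolevSpace κ p Ω) : Lp ℝ p (volume.restrict Ω) := v.1 β

/-- `v` and `g` are the same function on `Ω`. -/
def SobolevSpace.SameFunction {d κ : ℕ} {p p' : ℝ≥0∞} [Fact (1 ≤ p)]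
    {Ω : Set (EuclideanSpace ℝ (Fin d))}
    (v : SobolevSpace κ p Ω) (g : Lp ℝ p' (volume.restrict Ω)) : Prop :=
  ∀ᵐ x ∂(volume.restrict Ω), SobolevSpace.D (MultiIdx.zero d κ) v x = g x

/-! ### Sobolev-Bochner spaces -/

/-- Lebesgue measure on the time interval `(0, T)`. -/
abbrev timeMeasure (T : ℝ) : Measure ℝ := volume.restrict (Ioo 0 T)

/-- The dynamic state space `L^p(0,T;V) ∩ W^{1,p,p}(0,T;Ṽ)` for an embedding `ι : V → Ṽ`: pairs of
`u ∈ L^p(0,T;V)` and `w ∈ L^p(0,T;Ṽ)` such that `w` is the weak time derivative of `ι ∘ u`. The pair is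
determined by `u`; the norm is `max (‖u‖_{L^p(0,T;V)}) (‖∂ₜu‖_{L^p(0,T;Ṽ)})`. -/
def StateSpace {V Vt : Type*} [NormedAddCommGroup V] [NormedSpace ℝ V]
    [NormedAddCommGroup Vt] [NormedSpace ℝ Vt] (T : ℝ) (p : ℝ≥0∞) [Fact (1 ≤ p)]
    (ι : V →L[ℝ] Vt) : Submodule ℝ (Lp V p (timeMeasure T) × Lp Vt p (timeMeasure T)) where
  carrier := {z | ∀ φ : ℝ → ℝ, IsTestFunction (Ioo 0 T) φ →
    ∫ t in Ioo 0 T, deriv φ t • ι (z.1 t) = - ∫ t in Ioo 0 T, φ t • z.2 t}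
  zero_mem' := by
    intro φ _
    have h1 : ∫ t in Ioo 0 T, deriv φ t • ι ((0 : Lp V p (timeMeasure T)) t) = 0 := by
      rw [← integral_zero (α := ℝ) (G := Vt) (μ := timeMeasure T)]
      refine integral_congr_ae ?_
      filter_upwards [Lp.coeFn_zero V p (timeMeasure T)] with t ht
      rw [ht]
      simp
    have h2 : ∫ t in Ioo 0 T, φ t • (0 : Lp Vt p (timeMeasure T)) t = 0 := by
      rw [← integral_zero (α := ℝ) (G := Vt) (μ := timeMeasure T)]
      refine integral_congr_ae ?_
      filter_upwards [Lp.coeFn_zero Vt p (timeMeasure T)] with t ht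
      rw [ht]
      simp
    simp only [Prod.fst_zero, Prod.snd_zero, h1, h2, neg_zero]
  add_mem' := by
    intro y z hy hz φ hφ
    have hd : Continuous (deriv φ) := hφ.smooth.continuous_deriv (by simp)
    have hds : HasCompactSupport (deriv φ) := hφ.hasCompactSupport.deriv
    have hi : ∀ f : Lp V p (timeMeasure T),
        Integrable (fun t => deriv φ t • ι (f t)) (timeMeasure T) := by
      intro f
      have h := ι.integrable_comp (integrable_test_mul f hd hds)
      simpa using h
    have h1 : ∫ t in Ioo 0 T, deriv φ t • ι ((y + z).1 t) =
        (∫ t in Ioo 0 T, deriv φ t • ι (y.1 t)) + ∫ t in Ioo 0 T, deriv φ t • ι (z.1 t) := by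
      rw [← integral_add (hi y.1) (hi z.1)]
      refine integral_congr_ae ?_
      filter_upwards [Lp.coeFn_add y.1 z.1] with t ht
      rw [Prod.fst_add, ht, Pi.add_apply, map_add, smul_add]
    have h2 : ∫ t in Ioo 0 T, φ t • (y + z).2 t =
        (∫ t in Ioo 0 T, φ t • y.2 t) + ∫ t in Ioo 0 T, φ t • z.2 t := by
      rw [← integral_add
        (integrable_test_mul y.2 hφ.smooth.continuous hφ.hasCompactSupport)
        (integrable_test_mul z.2 hφ.smooth.continuous hφ.hasCompactSupport)]
      refine integral_congr_ae ?_
      filter_upwards [Lp.coeFn_add y.2 z.2] with t ht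
      rw [Prod.snd_add, ht, Pi.add_apply, smul_add]
    rw [h1, h2, hy φ hφ, hz φ hφ, neg_add]
  smul_mem' := by
    intro c z hz φ hφ
    have h1 : ∫ t in Ioo 0 T, deriv φ t • ι ((c • z).1 t) =
        c • ∫ t in Ioo 0 T, deriv φ t • ι (z.1 t) := by
      rw [← integral_smul]
      refine integral_congr_ae ?_
      filter_upwards [Lp.coeFn_smul c z.1] with t ht
      rw [Prod.smul_fst, ht, Pi.smul_apply, map_smul, smul_comm]
    have h2 : ∫ t in Ioo 0 T, φ t • (c • z).2 t = c • ∫ t in Ioo 0 T, φ t • z.2 t := by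
      rw [← integral_smul]
      refine integral_congr_ae ?_
      filter_upwards [Lp.coeFn_smul c z.2] with t ht
      rw [Prod.smul_snd, ht, Pi.smul_apply, smul_comm]
    rw [h1, h2, hz φ hφ, smul_neg]

namespace StateSpace

variable {V Vt : Type*} [NormedAddCommGroup V] [NormedSpace ℝ V]
  [NormedAddCommGroup Vt] [NormedSpace ℝ Vt] {T : ℝ} {p : ℝ≥0∞} [Fact (1 ≤ p)] {ι : V →L[ℝ] Vt}

/-- The state as a function of time with values in `V`. -/
def state (u : StateSpace T p ι) : Lp V p (timeMeasure T) := u.1.1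

/-- The weak time derivative of the state, a function of time with values in `Ṽ`. -/
def timeDeriv (u : StateSpace T p ι) : Lp Vt p (timeMeasure T) := u.1.2

end StateSpace

/-! ### Functional-analytic notions -/

/-- Reflexivity: the canonical embedding into the bidual is onto. -/
def IsReflexive (X : Type*) [NormedAddCommGroup X] [NormedSpace ℝ X] : Prop :=
  Function.Surjective (NormedSpace.inclusionInDoubleDual ℝ X)

/-- Weak convergence of a sequence. -/
def WeakTendsto {X : Type*} [NormedAddCommGroup X] [NormedSpace ℝ X] (x : ℕ → X) (a : X) : Prop :=
  ∀ Λ : StrongDual ℝ X, Tendsto (fun m => Λ (x m)) atTop (𝓝 (Λ a))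

/-- (Sequential) weak-strong continuity of a possibly nonlinear operator. -/
def WeakStrongContinuous {X Z : Type*} [NormedAddCommGroup X] [NormedSpace ℝ X]
    [NormedAddCommGroup Z] (K : X → Z) : Prop :=
  ∀ (x : ℕ → X) (a : X), WeakTendsto x a → Tendsto (fun m => K (x m)) atTop (𝓝 (K a))

/-- (Sequential) weak-weak continuity of a possibly nonlinear operator. -/
def WeakWeakContinuous {X Z : Type*} [NormedAddCommGroup X] [NormedSpace ℝ X]
    [NormedAddCommGroup Z] [NormedSpace ℝ Z] (K : X → Z) : Prop :=
  ∀ (x : ℕ → X) (a : X), WeakTendsto x a → WeakTendsto (fun m => K (x m)) (K a)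

/-- `N` is a norm on `X` that is equivalent to the given one. -/
def IsEquivalentNorm {X : Type*} [NormedAddCommGroup X] [NormedSpace ℝ X] (N : Seminorm ℝ X) :
    Prop :=
  ∃ c C : ℝ, 0 < c ∧ 0 < C ∧ ∀ x, c * ‖x‖ ≤ N x ∧ N x ≤ C * ‖x‖

/-- Proper, coercive, (weakly) lower semicontinuous functionals on a subset of a finite-dimensional
space. -/
structure IsRegularizer {X : Type*} [NormedAddCommGroup X] {Θ : Set X} (R₀ : Θ → ℝ≥0∞) : Prop where
  proper : ∃ θ, R₀ θ ≠ ⊤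
  coercive : Tendsto R₀ (Bornology.cobounded Θ) (𝓝 ⊤)
  lsc : LowerSemicontinuous R₀

/-! ### The space setup -/

/-- The static spaces and their embeddings. `Vk k` is the space `V_{k+1}`, for `k < κ`. All embeddings
are continuous injections that identify elements which are the same function, i.e. the triangles
formed by them commute. -/
structure SpaceSetup {d : ℕ} (κ : ℕ) (Ω : Set (EuclideanSpace ℝ (Fin d)))
    (ph qh : ℝ≥0∞) [Fact (1 ≤ ph)] [Fact (1 ≤ qh)]
    (V Vt W Y : Type*) (Vk : Fin κ → Type*)
    [NormedAddCommGroup V] [NormedSpace ℝ V] [NormedAddCommGroup Vt] [NormedSpace ℝ Vt]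
    [NormedAddCommGroup W] [NormedSpace ℝ W] [NormedAddCommGroup Y] [NormedSpace ℝ Y]
    [∀ k, NormedAddCommGroup (Vk k)] [∀ k, NormedSpace ℝ (Vk k)] where
  reflexive_V : IsReflexive V
  reflexive_Vt : IsReflexive Vt
  reflexive_W : IsReflexive W
  reflexive_Vk : ∀ k, IsReflexive (Vk k)
  separable_V : TopologicalSpace.SeparableSpace V
  separable_Vt : TopologicalSpace.SeparableSpace Vt
  separable_W : TopologicalSpace.SeparableSpace W
  separable_Vk : ∀ k, TopologicalSpace.SeparableSpace (Vk k)
  /-- `V ↪ Ṽ` -/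
  toVt : V →L[ℝ] Vt
  toVt_injective : Function.Injective toVt
  /-- `Ṽ ↪ W` -/
  vtToW : Vt →L[ℝ] W
  vtToW_injective : Function.Injective vtToW
  /-- the compact embedding `V ↪ W^{κ,p̂}(Ω)` -/
  toSob : V →L[ℝ] SobolevSpace κ ph Ω
  toSob_injective : Function.Injective toSob
  toSob_compact : IsCompactOperator toSob
  /-- `V ↪ Y` -/
  toY : V →L[ℝ] Y
  toY_injective : Function.Injective toY
  /-- `L^q̂(Ω) ↪ W` -/
  lqToW : Lp ℝ qh (volume.restrict Ω) →L[ℝ] W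
  lqToW_injective : Function.Injective lqToW
  /-- `L^p̂(Ω) ↪ V_k` -/
  lpToVk : ∀ k, Lp ℝ ph (volume.restrict Ω) →L[ℝ] Vk k
  lpToVk_injective : ∀ k, Function.Injective (lpToVk k)
  /-- `V_k ↪ L^q̂(Ω)` -/
  vkToLq : ∀ k, Vk k →L[ℝ] Lp ℝ qh (volume.restrict Ω)
  vkToLq_injective : ∀ k, Function.Injective (vkToLq k)
  vk_compat : ∀ k (f : Lp ℝ ph (volume.restrict Ω)), vkToLq k (lpToVk k f) =ᵐ[volume.restrict Ω] f
  v_compat : ∀ (v : V) (g : Lp ℝ qh (volume.restrict Ω)), SobolevSpace.SameFunction (toSob v) g →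
    vtToW (toVt v) = lqToW g
  /-- either `W^{κ,p̂}(Ω) ↪ Ṽ` or `Ṽ ↪ W^{κ,p̂}(Ω)` -/
  sob_vt :
    (∃ j : SobolevSpace κ ph Ω →L[ℝ] Vt, Function.Injective j ∧
      ∀ (s : SobolevSpace κ ph Ω) (g : Lp ℝ qh (volume.restrict Ω)), SobolevSpace.SameFunction s g →
        vtToW (j s) = lqToW g) ∨
    (∃ j : Vt →L[ℝ] SobolevSpace κ ph Ω, Function.Injective j ∧
      ∀ (w : Vt) (g : Lp ℝ qh (volume.restrict Ω)), SobolevSpace.SameFunction (j w) g →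
        vtToW w = lqToW g)

namespace SpaceSetup

variable {d κ : ℕ} {Ω : Set (EuclideanSpace ℝ (Fin d))}
  {ph qh : ℝ≥0∞} [Fact (1 ≤ ph)] [Fact (1 ≤ qh)]
  {V Vt W Y : Type*} {Vk : Fin κ → Type*}
  [NormedAddCommGroup V] [NormedSpace ℝ V] [NormedAddCommGroup Vt] [NormedSpace ℝ Vt]
  [NormedAddCommGroup W] [NormedSpace ℝ W] [NormedAddCommGroup Y] [NormedSpace ℝ Y]
  [∀ k, NormedAddCommGroup (Vk k)] [∀ k, NormedSpace ℝ (Vk k)]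
  (S : SpaceSetup κ Ω ph qh V Vt W Y Vk)

/-- The dynamic state space `𝒱 = L^p(0,T;V) ∩ W^{1,p,p}(0,T;Ṽ)`. -/
abbrev State (T : ℝ) (p : ℝ≥0∞) [Fact (1 ≤ p)] := StateSpace T p S.toVt

/-- The values `(D^β v (x))_{|β| ≤ κ}` of `𝒥_κ v` at `x ∈ Ω`. -/
def jet (v : V) (x : EuclideanSpace ℝ (Fin d)) (β : MultiIdx d κ) : ℝ := SobolevSpace.D β (S.toSob v) x

/-- Uniform state space regularity `‖𝒥_κ v‖_{L^∞((0,T)×Ω)} ≤ c ‖v‖_𝒱`. -/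
def UniformRegularity (T : ℝ) (p : ℝ≥0∞) [Fact (1 ≤ p)] : Prop :=
  ∃ c : ℝ, 0 < c ∧ ∀ v : S.State T p, ∀ᵐ t ∂timeMeasure T, ∀ᵐ x ∂volume.restrict Ω,
    ∀ β, |S.jet (StateSpace.state v t) x β| ≤ c * ‖v‖

variable (A : Architecture) {τ : ℕ} (enc : Fin (A.width 0) ≃ Fin τ ⊕ MultiIdx d κ)

/-- The function `x ↦ 𝔖^θ(t, 𝒥_κ v(x))` (for `τ = 1`) or `x ↦ 𝔖^θ(𝒥_κ v(x))` (for `τ = 0`) on `Ω`. The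
bijection `enc` enumerates the input coordinates of the network, which are `τ` copies of the time
variable and the derivatives `D^β v`, `|β| ≤ κ`. -/
def networkField (θ : A.Coeffs) (t : ℝ) (v : V) (x : EuclideanSpace ℝ (Fin d)) : ℝ :=
  A.eval θ fun j => Sum.elim (fun _ => t) (S.jet v x) (enc j)

open Classical in
/-- The Nemytskii operator of the network at time `t`, with values in `L^q̂(Ω) ↪ W`. The second
branch only serves to make the definition total: by the uniform state space regularity the first one
applies to `v = u(t)` for `u ∈ 𝒱` and almost every `t`. -/
def nemytskii (θ : A.Coeffs) (t : ℝ) (v : V) : W :=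
  if h : MemLp (S.networkField A enc θ t v) qh (volume.restrict Ω) then S.lqToW (h.toLp _) else 0

/-- The residual `∂ₜu - 𝔖^θ(𝒥_κ u)` as a function of time with values in `W`. -/
def residual {T : ℝ} {p : ℝ≥0∞} [Fact (1 ≤ p)] (θ : A.Coeffs) (u : S.State T p) (t : ℝ) : W :=
  S.vtToW (StateSpace.timeDeriv u t) - S.nemytskii A enc θ t (StateSpace.state u t)

/-- `u` solves `∂ₜu = 𝔖^θ(𝒥_κ u)`: for almost every `t ∈ (0,T)` the right-hand side is in `L^q̂(Ω)` and
the equation holds in `W`. -/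
def SolvesPDE {T : ℝ} {p : ℝ≥0∞} [Fact (1 ≤ p)] (θ : A.Coeffs) (u : S.State T p) : Prop :=
  ∀ᵐ t ∂timeMeasure T, MemLp (S.networkField A enc θ t (StateSpace.state u t)) qh (volume.restrict Ω) ∧
    S.vtToW (StateSpace.timeDeriv u t) = S.nemytskii A enc θ t (StateSpace.state u t)

/-- The regularization functional `ℛ(u, θ) = ‖u‖_𝒱^p + ℛ₀(θ)`, where `N` is the norm of `𝒱`. -/
def regularization {T : ℝ} {p : ℝ≥0∞} [Fact (1 ≤ p)] (N : Seminorm ℝ (S.State T p))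
    {Θ : Set A.Coeffs} (R₀ : Θ → ℝ≥0∞) (u : S.State T p) (θ : Θ) : ℝ≥0∞ :=
  ENNReal.ofReal (N u ^ p.toReal) + R₀ θ

/-- The all-at-once functional
`λ ‖∂ₜu - 𝔖^θ(𝒥_κ u)‖_𝒲^q + μ ‖K u - y‖_𝒴^r + ℛ(u, θ)` with `𝒲 = L^q(0,T;W)`, `𝒴 = L^r(0,T;Y)`. -/
def objective {T : ℝ} {p : ℝ≥0∞} [Fact (1 ≤ p)] (q : ℝ≥0∞) {r : ℝ≥0∞} [Fact (1 ≤ r)]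
    (N : Seminorm ℝ (S.State T p)) {Θ : Set A.Coeffs} (R₀ : Θ → ℝ≥0∞)
    (lam mu : ℝ) (K : S.State T p → Lp Y r (timeMeasure T)) (y : Lp Y r (timeMeasure T))
    (u : S.State T p) (θ : Θ) : ℝ≥0∞ :=
  ENNReal.ofReal lam * eLpNorm (S.residual A enc θ.1 u) q (timeMeasure T) ^ q.toReal
    + ENNReal.ofReal (mu * ‖K u - y‖ ^ r.toReal)
    + S.regularization A N R₀ u θ

end SpaceSetup

end SymNet

end

open SymNet

/-! Comparing a minimizer with `(ud, η)`, where `η` solves the limit equation at `ud`, kills the PDE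
residual and leaves at most `mu m * δ m` from the data term. Hence the objective at the minimizers
is at most `mu m * δ m` plus the regularization of `(ud, η)`. Taking `η = θd` bounds the objectives.
The states are then bounded, the parameters lie in a sublevel set of the coercive `R₀`, and, since
both weights tend to infinity, the PDE residuals and the data misfits tend to zero.

Bounded states have weakly convergent subsequences. This rests on weak sequential compactness in
`L^p(0,T;V)` for reflexive separable `V`, obtained by representing the dual as `L^{p'}(0,T;V*)`
(`dualPairing_surjective`) and applying sequential Banach-Alaoglu. For a weak subsequential limit,
the vanishing misfit, the convergence of `K m` to `Kd` along weakly convergent sequences and the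
weak-strong continuity of `Kd` give equal data under `Kd`; injectivity makes the limit `ud`. So the
whole sequence of states converges weakly to `ud`.

The equation passes to the limit although it is nonlinear in the jet (`solvesPDE_of_tendsto`). An
argument of Aubin-Lions type upgrades weak convergence of states to strong convergence in the
Sobolev space at almost every time, along a subsequence. Uniform regularity keeps all jets in one
cube, so the network may be truncated outside it, and bounded convergence handles the nonlinear
term. The time derivative converges only weakly, which suffices because it enters linearly.

Locally uniform convergence of the networks is joint continuity in parameter and input, guaranteed
by the lower bound `ε` on the denominators. Optimality of the limiting parameter follows from the
comparison inequality, weak lower semicontinuity of the norm and lower semicontinuity of `R₀`. -/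

noncomputable section

namespace SymNet

/-! ### Converse Hölder inequality and densities of functionals on `L^p(μ; E)`. -/

section LpDuality

variable {α E : Type*} [MeasurableSpace α] {μ : Measure α} [NormedAddCommGroup E] [NormedSpace ℝ E]
  {p p' : ℝ≥0∞}

/-- The converse of Hölder's inequality, tested with simple functions. -/
theorem lintegral_rpow_le_of_forall_simpleFunc [IsFiniteMeasure μ] [p.HolderConjugate p'] (hp : p ≠ ⊤) (hp1 : 1 < p)

    {k : α → ℝ} (hk : StronglyMeasurable k) (hki : Integrable k μ) {C : ℝ} (hC : 0 ≤ C)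
    (h : ∀ s : SimpleFunc α ℝ, ∫ t, s t * k t ∂μ ≤ C * (eLpNorm s p μ).toReal) :
    ∫⁻ t, ‖k t‖ₑ ^ p'.toReal ∂μ ≤ ENNReal.ofReal (C ^ p'.toReal) := by
  have hconj : p.toReal.HolderConjugate p'.toReal := by
    refine (ENNReal.HolderConjugate.toReal_iff ?_).2 inferInstance
    rw [← ENNReal.toReal_one]
    exact (ENNReal.toReal_lt_toReal ENNReal.one_ne_top hp).2 hp1
  have hP : 0 < p.toReal := hconj.pos
  have hQ : 0 < p'.toReal := hconj.symm.pos
  -- Testing against simple minorants `b` of `|k|^p'` keeps every integral finite, since `k` is not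
  -- yet known to lie in `L^{p'}`.
  rw [lintegral_eq_nnreal]
  refine iSup₂_le fun b hb => ?_
  set I : ℝ := ∫ t, (b t : ℝ) ∂μ with hI
  let sg : SimpleFunc α ℝ := SimpleFunc.piecewise {t | 0 ≤ k t}
    (measurableSet_le measurable_const hk.measurable) (SimpleFunc.const α 1) (SimpleFunc.const α (-1))
  -- The extremal test function `sign(k) b^{1/p}`: its `L^p` norm is `I^{1/p}`, and `s k ≥ b`
  -- because `|k| ≥ b^{1/p'}`. This yields `I ≤ C I^{1/p}`, and a positive finite `I` can be divided
  -- out.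
  let s : SimpleFunc α ℝ := sg * b.map fun y : NNReal => (y : ℝ) ^ (1 / p.toReal)
  have hbI : Integrable (fun t => (b t : ℝ)) μ :=
    SimpleFunc.integrable_of_isFiniteMeasure (b.map ((↑) : NNReal → ℝ))
  have hs : ∀ t, s t = sg t * (b t : ℝ) ^ (1 / p.toReal) := fun t => rfl
  have hsg : ∀ t, sg t * k t = |k t| := by
    intro t
    by_cases ht : 0 ≤ k t
    · simp [sg, SimpleFunc.coe_piecewise, ht, abs_of_nonneg]
    · simp [sg, SimpleFunc.coe_piecewise, ht, abs_of_neg (not_le.1 ht)]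
  have hsg' : ∀ t, |sg t| = 1 := by
    intro t
    by_cases ht : 0 ≤ k t <;> simp [sg, SimpleFunc.coe_piecewise, ht]
  have hI0 : 0 ≤ I := integral_nonneg fun t => (b t).coe_nonneg
  have hIs : (eLpNorm s p μ).toReal = I ^ (1 / p.toReal) := by
    rw [eLpNorm_eq_lintegral_rpow_enorm_toReal (ne_of_gt (zero_lt_one.trans hp1)) hp,
      ← ENNReal.toReal_rpow]
    congr 1
    rw [hI, integral_eq_lintegral_of_nonneg_ae (Eventually.of_forall fun t => (b t).coe_nonneg)
      hbI.aestronglyMeasurable]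
    congr 1
    refine lintegral_congr fun t => ?_
    rw [← ofReal_norm, Real.norm_eq_abs, hs, abs_mul, hsg', one_mul,
      abs_of_nonneg (by positivity), ENNReal.ofReal_rpow_of_nonneg (by positivity) hP.le,
      ← Real.rpow_mul (b t).coe_nonneg, one_div_mul_cancel hP.ne', Real.rpow_one]
  have hle : I ≤ C * I ^ (1 / p.toReal) := by
    rw [← hIs]
    refine le_trans ?_ (h s)
    have hint : Integrable (fun t => s t * k t) μ := by
      obtain ⟨B, hB⟩ := s.exists_forall_norm_le
      exact hki.bdd_mul s.stronglyMeasurable.aestronglyMeasurable (Eventually.of_forall hB)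
    refine integral_mono hbI hint fun t => ?_
    have hbt := hb t
    have h1 : (b t : ℝ) ≤ |k t| ^ p'.toReal := by
      rw [← ofReal_norm, ENNReal.ofReal_rpow_of_nonneg (norm_nonneg _) hQ.le] at hbt
      rw [← ENNReal.ofReal_coe_nnreal] at hbt
      exact (ENNReal.ofReal_le_ofReal_iff (by positivity)).1 hbt
    have h2 : (b t : ℝ) ^ (1 / p'.toReal) ≤ |k t| := by
      have := Real.rpow_le_rpow (b t).coe_nonneg h1 (by positivity : 0 ≤ 1 / p'.toReal)
      rwa [← Real.rpow_mul (abs_nonneg _), mul_one_div_cancel hQ.ne', Real.rpow_one] at this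
    have h3 : (b t : ℝ) = (b t : ℝ) ^ (1 / p.toReal) * (b t : ℝ) ^ (1 / p'.toReal) := by
      have hone : 1 / p.toReal + 1 / p'.toReal = 1 := by
        simpa [one_div] using hconj.inv_add_inv_eq_one
      rw [← Real.rpow_add_of_nonneg (b t).coe_nonneg (by positivity) (by positivity), hone, Real.rpow_one]
    change (b t : ℝ) ≤ s t * k t
    rw [hs, mul_right_comm, hsg, mul_comm]
    conv_lhs => rw [h3]
    gcongr
  have hfin : I ≤ C ^ p'.toReal := by
    rcases hI0.eq_or_lt with h0 | h0
    · rw [← h0]; positivity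
    · have hone : 1 / p'.toReal = 1 - 1 / p.toReal := by
        have := hconj.inv_add_inv_eq_one
        simp only [one_div]; linarith
      have h1 : I ^ (1 / p'.toReal) ≤ C := by
        rw [hone, Real.rpow_sub h0, Real.rpow_one, div_le_iff₀ (by positivity)]
        exact hle
      have := Real.rpow_le_rpow (by positivity) h1 hQ.le
      rwa [← Real.rpow_mul hI0, one_div_mul_cancel hQ.ne', Real.rpow_one] at this
  rw [← SimpleFunc.lintegral_eq_lintegral]
  have : ∫⁻ t, (b.map ((↑) : NNReal → ℝ≥0∞)) t ∂μ = ENNReal.ofReal I := by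
    rw [hI, ofReal_integral_eq_lintegral_ofReal hbI (Eventually.of_forall fun t => (b t).coe_nonneg)]
    simp
  rw [this]
  exact ENNReal.ofReal_le_ofReal hfin

/-- The map `x ↦ 1_A x` into `L^p(μ; E)`. -/
def indicatorLp (p : ℝ≥0∞) [Fact (1 ≤ p)] (μ : Measure α) [IsFiniteMeasure μ] (E : Type*)
    [NormedAddCommGroup E] [NormedSpace ℝ E] {A : Set α} (hA : MeasurableSet A) :
    E →L[ℝ] Lp E p μ :=
  LinearMap.mkContinuous
    { toFun := fun x => indicatorConstLp p hA (measure_ne_top μ A) x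
      map_add' := fun x y => (indicatorConstLp_add ..).symm
      map_smul' := fun c x => by
        rw [RingHom.id_apply]
        refine Lp.ext ?_
        filter_upwards [indicatorConstLp_coeFn (p := p) (hs := hA) (hμs := measure_ne_top μ A) (c := c • x),
          indicatorConstLp_coeFn (p := p) (hs := hA) (hμs := measure_ne_top μ A) (c := x),
          Lp.coeFn_smul c (indicatorConstLp p hA (measure_ne_top μ A) x)] with t h1 h2 h3
        rw [h1, h3, Pi.smul_apply, h2]
        by_cases ht : t ∈ A <;> simp [ht] }
    (μ.real A ^ (1 / p.toReal)) fun x => by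
      rw [mul_comm]
      exact norm_indicatorConstLp_le (hs := hA) (hμs := measure_ne_top μ A)

variable [Fact (1 ≤ p)] [IsFiniteMeasure μ]

theorem indicatorLp_apply {A : Set α} (hA : MeasurableSet A) (x : E) :
    indicatorLp p μ E hA x = indicatorConstLp p hA (measure_ne_top μ A) x := rfl

/-- Radon-Nikodym for the signed measure `A ↦ Λ(1_A x)`. Countable additivity needs `p ≠ ⊤`: only
then do indicators of increasing finite unions converge in `L^p`. Absolute continuity holds because
`1_A x` vanishes in `L^p` for null `A`. -/
theorem exists_density (hp : p ≠ ⊤) (Λ : StrongDual ℝ (Lp E p μ)) (x : E) :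
    ∃ k : α → ℝ, StronglyMeasurable k ∧ Integrable k μ ∧
      ∀ A (hA : MeasurableSet A), Λ (indicatorLp p μ E hA x) = ∫ t in A, k t ∂μ := by
  classical
  let m : SignedMeasure α :=
    { measureOf' := fun A => if hA : MeasurableSet A then Λ (indicatorLp p μ E hA x) else 0
      empty' := by simp [indicatorLp_apply]
      not_measurable' := fun A hA => by simp [hA]
      m_iUnion' := by
        intro f hf hd
        have hU := MeasurableSet.iUnion hf
        have hs : ∀ s : Finset ℕ, MeasurableSet (⋃ i ∈ s, f i) := fun s =>
          s.measurableSet_biUnion fun i _ => hf i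
        have hsum : ∀ s : Finset ℕ, ∑ i ∈ s, indicatorLp p μ E (hf i) x =
            indicatorLp p μ E (hs s) x := by
          intro s
          induction s using Finset.induction_on with
          | empty => simp [indicatorLp_apply]
          | insert a s ha ih =>
            rw [Finset.sum_insert ha, ih]
            have hdis : Disjoint (f a) (⋃ i ∈ s, f i) := by
              rw [Set.disjoint_iUnion₂_right]
              intro i hi
              exact hd fun h => ha (h ▸ hi)
            have := indicatorConstLp_disjoint_union (p := p) (hf a) (hs s) (measure_ne_top μ _)
              (measure_ne_top μ _) hdis x
            simp only [indicatorLp_apply]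
            rw [← this]
            congr 1
            simp
        simp only [hf, hU, dif_pos]
        -- The measure of the symmetric difference is the tail of the convergent series `∑ μ (f i)`.
        have h0 : Tendsto (fun s : Finset ℕ => μ (symmDiff (⋃ i ∈ s, f i) (⋃ i, f i))) atTop (𝓝 0) := by
          have h1 : ∀ s : Finset ℕ, μ (symmDiff (⋃ i ∈ s, f i) (⋃ i, f i)) =
              μ (⋃ i, f i) - ∑ i ∈ s, μ (f i) := by
            intro s
            have hsub : (⋃ i ∈ s, f i) ⊆ ⋃ i, f i := Set.iUnion₂_subset fun i _ => Set.subset_iUnion f i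
            rw [symmDiff_of_le hsub, measure_sdiff hsub (hs s).nullMeasurableSet (measure_ne_top _ _),
              measure_biUnion_finset (fun i _ j _ hij => hd hij) fun i _ => hf i]
          simp_rw [h1]
          have h2 := (ENNReal.summable (f := fun i => μ (f i))).hasSum
          rw [← measure_iUnion hd hf] at h2
          have h3 := ENNReal.Tendsto.sub (tendsto_const_nhds (x := μ (⋃ i, f i))) h2
            (Or.inl (measure_ne_top _ _))
          simpa using h3
        have h4 := tendsto_indicatorConstLp_set (p := p) (c := x) (hs := hU)
          (hμs := measure_ne_top μ _) (ht := hs) (hμt := fun s => measure_ne_top μ _) hp h0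
        have h5 := (Λ.continuous.tendsto _).comp h4
        refine h5.congr fun s => ?_
        simp only [Function.comp]
        rw [← map_sum, hsum]
        rfl }
  have hac : m ≪ᵥ μ.toENNRealVectorMeasure := by
    refine VectorMeasure.AbsolutelyContinuous.mk fun A hA h0 => ?_
    rw [Measure.toENNRealVectorMeasure_apply_measurable hA] at h0
    change (if hA : MeasurableSet A then Λ (indicatorLp p μ E hA x) else 0) = 0
    rw [dif_pos hA]
    have : indicatorLp p μ E hA x = 0 := by
      rw [← norm_eq_zero]
      refine le_antisymm (le_trans (norm_indicatorConstLp_le (hs := hA) (hμs := measure_ne_top μ A)) ?_) (norm_nonneg _)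
      have hp0 : 0 < p.toReal := ENNReal.toReal_pos (zero_lt_one.trans_le Fact.out).ne' hp
      rw [Measure.real, h0, ENNReal.toReal_zero, Real.zero_rpow (by positivity), mul_zero]
    rw [this, map_zero]
  refine ⟨m.rnDeriv μ, (SignedMeasure.measurable_rnDeriv m μ).stronglyMeasurable,
    SignedMeasure.integrable_rnDeriv m μ, fun A hA => ?_⟩
  have h := SignedMeasure.withDensityᵥ_rnDeriv_eq m μ hac
  rw [← withDensityᵥ_apply (SignedMeasure.integrable_rnDeriv m μ) hA, h]
  change _ = if hA : MeasurableSet A then Λ (indicatorLp p μ E hA x) else 0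
  rw [dif_pos hA]

end LpDuality

/-! ### Majorants for countably many densities, and measurable dual-valued functions. -/

section LpDuality

variable {α E : Type*} [MeasurableSpace α] {μ : Measure α} [NormedAddCommGroup E] [NormedSpace ℝ E]
  {p p' : ℝ≥0∞} [Fact (1 ≤ p)] [IsFiniteMeasure μ]

/-- The action of a functional on a simple function `∑ 1_{A_c} s(c) x(i(c))`, in terms of densities. -/
theorem dual_toLp_simpleFunc {ι : Type*} (Λ : StrongDual ℝ (Lp E p μ)) {x : ι → E} {k : ι → α → ℝ}
    (hki : ∀ i, Integrable (k i) μ)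
    (hk : ∀ i A (hA : MeasurableSet A), Λ (indicatorLp p μ E hA (x i)) = ∫ t in A, k i t ∂μ)
    (j : SimpleFunc α ι) (s : SimpleFunc α ℝ) (hf : MemLp (fun t => s t • x (j t)) p μ) :
    Λ (hf.toLp _) = ∫ t, s t * k (j t) t ∂μ := by
  classical
  -- On each fibre of the pair both the scalar and the selected vector are constant.
  let c : SimpleFunc α (ℝ × ι) := s.pair j
  have hm : ∀ a, MeasurableSet (c ⁻¹' {a}) := c.measurableSet_fiber
  have h1 : hf.toLp _ = ∑ a ∈ c.range, a.1 • indicatorLp p μ E (hm a) (x a.2) := by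
    refine Lp.ext ?_
    have h2 : ∀ᵐ t ∂μ, ∀ a ∈ c.range, (a.1 • indicatorLp p μ E (hm a) (x a.2) : Lp E p μ) t =
        (c ⁻¹' {a}).indicator (fun _ => a.1 • x a.2) t := by
      rw [eventually_all_finset]
      intro a _
      filter_upwards [Lp.coeFn_smul a.1 (indicatorLp p μ E (hm a) (x a.2)),
        indicatorConstLp_coeFn (p := p) (hs := hm a) (hμs := measure_ne_top μ _) (c := x a.2)]
        with t h3 h4
      rw [h3, Pi.smul_apply, indicatorLp_apply, h4]
      by_cases ht : t ∈ c ⁻¹' {a} <;> simp [ht]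
    filter_upwards [hf.coeFn_toLp, Lp.coeFn_finsetSum c.range fun a => a.1 • indicatorLp p μ E (hm a) (x a.2), h2] with t h3 h4 h5
    rw [h3, h4, Finset.sum_apply, Finset.sum_congr rfl h5, Finset.sum_eq_single (c t)]
    · simp [c]
    · intro a _ ha
      simp [ha.symm]
    · intro h
      exact absurd (c.mem_range_self t) h
  rw [h1, map_sum]
  have h6 : ∀ t, s t * k (j t) t = ∑ a ∈ c.range, (c ⁻¹' {a}).indicator (fun t => a.1 * k a.2 t) t := by
    intro t
    rw [Finset.sum_eq_single (c t)]
    · simp [c]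
    · intro a _ ha
      simp [ha.symm]
    · intro h
      exact absurd (c.mem_range_self t) h
  simp_rw [h6]
  rw [integral_finsetSum]
  · refine Finset.sum_congr rfl fun a _ => ?_
    rw [map_smul, hk, integral_indicator (hm a), integral_const_mul, smul_eq_mul]
  · exact fun a _ => ((hki a.2).const_mul a.1).indicator (hm a)

/-- Multiplying a scalar test function by a selection of vectors from the unit ball does not
increase its norm, so converse Hölder gives a bound independent of the selection. Selecting the
largest of finitely many densities at each point thus controls their maximum at no extra cost. -/
theorem lintegral_selection_le [p.HolderConjugate p'] (hp : p ≠ ⊤) (hp1 : 1 < p)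
    {ι : Type*} (Λ : StrongDual ℝ (Lp E p μ)) {x : ι → E} (hx : ∀ i, ‖x i‖ ≤ 1) {k : ι → α → ℝ}
    (hkm : ∀ i, StronglyMeasurable (k i)) (hki : ∀ i, Integrable (k i) μ)
    (hk : ∀ i A (hA : MeasurableSet A), Λ (indicatorLp p μ E hA (x i)) = ∫ t in A, k i t ∂μ)
    (j : SimpleFunc α ι) :
    ∫⁻ t, ‖k (j t) t‖ₑ ^ p'.toReal ∂μ ≤ ENNReal.ofReal (‖Λ‖ ^ p'.toReal) := by
  classical
  have hsum : (fun t => k (j t) t) = fun t => ∑ i ∈ j.range, (j ⁻¹' {i}).indicator (k i) t := by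
    funext t
    rw [Finset.sum_eq_single (j t)]
    · simp
    · intro a _ ha
      simp [ha.symm]
    · intro h
      exact absurd (j.mem_range_self t) h
  refine lintegral_rpow_le_of_forall_simpleFunc (p := p) (k := fun t => k (j t) t) hp hp1 ?_ ?_
    (norm_nonneg Λ) fun s => ?_
  · rw [hsum]
    exact Finset.stronglyMeasurable_fun_sum _ fun i _ => (hkm i).indicator (j.measurableSet_fiber i)
  · rw [hsum]
    exact integrable_finsetSum _ fun i _ => (hki i).indicator (j.measurableSet_fiber i)
  · have hle : ∀ t, ‖s t • x (j t)‖ ≤ ‖s t‖ := fun t => by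
      rw [norm_smul]
      exact mul_le_of_le_one_right (norm_nonneg _) (hx _)
    have hs : MemLp s p μ := s.memLp_of_isFiniteMeasure p μ
    have hmeas : AEStronglyMeasurable (fun t => s t • x (j t)) μ :=
      s.stronglyMeasurable.aestronglyMeasurable.smul
        (j.map x).stronglyMeasurable.aestronglyMeasurable
    have hf : MemLp (fun t => s t • x (j t)) p μ := hs.of_le hmeas (Eventually.of_forall hle)
    rw [← dual_toLp_simpleFunc Λ hki hk j s hf]
    refine (le_abs_self _).trans ((Λ.le_opNorm _).trans ?_)
    gcongr
    rw [Lp.norm_toLp]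
    exact ENNReal.toReal_mono hs.eLpNorm_ne_top (eLpNorm_mono hle)

/-- Densities belonging to countably many unit vectors have a common majorant in `L^{p'}`. -/
theorem exists_memLp_majorant [p.HolderConjugate p'] (hp : p ≠ ⊤) (hp1 : 1 < p)
    (Λ : StrongDual ℝ (Lp E p μ)) {x : ℕ → E} (hx : ∀ i, ‖x i‖ ≤ 1) {k : ℕ → α → ℝ}
    (hkm : ∀ i, StronglyMeasurable (k i)) (hki : ∀ i, Integrable (k i) μ)
    (hk : ∀ i A (hA : MeasurableSet A), Λ (indicatorLp p μ E hA (x i)) = ∫ t in A, k i t ∂μ) :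
    ∃ G : α → ℝ, MemLp G p' μ ∧ ∀ᵐ t ∂μ, ∀ i, |k i t| ≤ G t := by
  have hp'1 : 1 < p'.toReal := by
    refine ((ENNReal.HolderConjugate.toReal_iff (p := p) ?_).2 inferInstance).symm.lt
    rw [← ENNReal.toReal_one]
    exact (ENNReal.toReal_lt_toReal ENNReal.one_ne_top hp).2 hp1
  have hp'0 : p' ≠ 0 := by rintro rfl; simp at hp'1; linarith
  have hp't : p' ≠ ⊤ := by rintro rfl; simp at hp'1; linarith
  -- A measurable index at which the maximum over the first `n + 1` densities is attained.
  have hsel : ∀ n, ∃ j : SimpleFunc α ℕ, ∀ t, ∀ i ≤ n, ‖k i t‖ₑ ≤ ‖k (j t) t‖ₑ := by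
    intro n
    induction n with
    | zero => exact ⟨SimpleFunc.const α 0, fun t i hi => by simp [Nat.le_zero.1 hi]⟩
    | succ n ih =>
      obtain ⟨j, hj⟩ := ih
      have hjm : Measurable fun t => ‖k (j t) t‖ₑ := by
        have h := measurable_from_prod_countable_right (f := fun z : ℕ × α => ‖k z.1 z.2‖ₑ)
          fun i => (hkm i).measurable.enorm
        exact h.comp (j.measurable.prodMk measurable_id)
      have hS : MeasurableSet {t | ‖k (n + 1) t‖ₑ ≤ ‖k (j t) t‖ₑ} :=
        measurableSet_le (hkm _).measurable.enorm hjm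
      refine ⟨SimpleFunc.piecewise _ hS j (SimpleFunc.const α (n + 1)), fun t i hi => ?_⟩
      by_cases ht : ‖k (n + 1) t‖ₑ ≤ ‖k (j t) t‖ₑ
      · rw [SimpleFunc.piecewise_apply, if_pos (by exact ht)]
        rcases Nat.le_succ_iff.1 hi with h | rfl
        · exact hj t i h
        · exact ht
      · rw [SimpleFunc.piecewise_apply, if_neg (by exact ht)]
        rcases Nat.le_succ_iff.1 hi with h | rfl
        · exact (hj t i h).trans (not_le.1 ht).le
        · exact le_rfl
  have hmeas : ∀ i, Measurable fun t => ‖k i t‖ₑ ^ p'.toReal := fun i =>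
    (hkm i).measurable.enorm.pow_const _
  have hint : ∫⁻ t, (⨆ i, ‖k i t‖ₑ) ^ p'.toReal ∂μ ≤ ENNReal.ofReal (‖Λ‖ ^ p'.toReal) := by
    have h1 : ∀ t, (⨆ i, ‖k i t‖ₑ) ^ p'.toReal = ⨆ n, (partialSups fun i => ‖k i t‖ₑ ^ p'.toReal) n := by
      intro t
      rw [iSup_partialSups_eq]
      exact (ENNReal.orderIsoRpow _ (by linarith)).map_iSup _
    simp_rw [h1]
    -- Monotone convergence carries the bound from finite maxima to the supremum.
    rw [lintegral_iSup]
    · refine iSup_le fun n => ?_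
      obtain ⟨j, hj⟩ := hsel n
      refine (lintegral_mono fun t => ?_).trans (lintegral_selection_le hp hp1 Λ hx hkm hki hk j)
      refine partialSups_le _ _ _ fun i hi => ?_
      gcongr
      exact hj t i hi
    · intro n
      simp only [partialSups_apply]
      convert! Finset.measurable_sup' (Finset.nonempty_Iic (a := n)) fun i _ => hmeas i using 1
      funext t
      rw [Finset.sup'_apply]
    · intro n m hnm t
      exact (partialSups _).monotone hnm
  have hG : Measurable fun t => ⨆ i, ‖k i t‖ₑ := .iSup fun i => (hkm i).measurable.enorm
  have hfin : ∀ᵐ t ∂μ, (⨆ i, ‖k i t‖ₑ) < ⊤ := by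
    have := ae_lt_top (hG.pow_const p'.toReal) (hint.trans_lt ENNReal.ofReal_lt_top).ne
    filter_upwards [this] with t ht
    exact (ENNReal.rpow_lt_top_iff_of_pos (by linarith)).1 ht
  refine ⟨fun t => (⨆ i, ‖k i t‖ₑ).toReal, ⟨hG.ennreal_toReal.aestronglyMeasurable, ?_⟩, ?_⟩
  · refine (eLpNorm_lt_top_iff_lintegral_rpow_enorm_lt_top hp'0 hp't).2 ?_
    refine lt_of_le_of_lt (lintegral_mono fun t => ?_) (hint.trans_lt ENNReal.ofReal_lt_top)
    gcongr
    rw [Real.enorm_eq_ofReal ENNReal.toReal_nonneg]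
    exact ENNReal.ofReal_toReal_le
  · filter_upwards [hfin] with t ht i
    have h := ENNReal.toReal_mono ht.ne (le_iSup (fun i => ‖k i t‖ₑ) i)
    simpa using h

/-- A functional with prescribed values on a sequence of vectors. -/
theorem exists_dual_of_forall_rat_le (v : ℕ → E) (γ : ℕ → ℝ) {M : ℝ} (hM : 0 ≤ M)
    (h : ∀ (n : ℕ) (c : Fin n → ℚ), |∑ i, (c i : ℝ) * γ i| ≤ M * ‖∑ i, (c i : ℝ) • v i‖) :
    ∃ ξ : StrongDual ℝ E, ‖ξ‖ ≤ M ∧ ∀ i, ξ (v i) = γ i := by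
  have hreal : ∀ (n : ℕ) (c : Fin n → ℝ), |∑ i, c i * γ i| ≤ M * ‖∑ i, c i • v i‖ := by
    intro n c
    have hd : DenseRange (fun (c : Fin n → ℚ) i => (c i : ℝ)) :=
      DenseRange.piMap fun _ => Rat.denseRange_cast
    refine hd.induction_on (p := fun c : Fin n → ℝ => |∑ i, c i * γ i| ≤ M * ‖∑ i, c i • v i‖) c
      (isClosed_le (by fun_prop) (by fun_prop)) fun c => h n c
  let Φ := Finsupp.linearCombination ℝ v
  let Γ := Finsupp.linearCombination ℝ γ
  have hbd : ∀ a, |Γ a| ≤ M * ‖Φ a‖ := by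
    intro a
    obtain ⟨n, hn⟩ := a.support.exists_nat_subset_range
    have h1 := hreal n fun i => a i
    simp only [Φ, Γ]
    rw [Finsupp.linearCombination_apply, Finsupp.sum_of_support_subset _ hn _ (by simp),
      Finset.sum_range, Finsupp.linearCombination_apply, Finsupp.sum_of_support_subset _ hn _ (by simp),
      Finset.sum_range]
    exact h1
  -- Any linear section works: the bound `hbd` forces `Γ` to vanish on the kernel of `Φ`, so `Γ ∘ σ`
  -- does not depend on the choice.
  obtain ⟨σ, hσ⟩ := Φ.rangeRestrict.exists_rightInverse_of_surjective Φ.range_rangeRestrict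
  have hσ' : ∀ y : LinearMap.range Φ, Φ (σ y) = y := fun y =>
    congrArg Subtype.val (LinearMap.congr_fun hσ y)
  let f : StrongDual ℝ (LinearMap.range Φ) := (Γ ∘ₗ σ).mkContinuous M fun y => by
    have := hbd (σ y)
    rw [hσ'] at this
    exact this
  obtain ⟨ξ, hξ, hξn⟩ := exists_extension_norm_eq (LinearMap.range Φ) f
  refine ⟨ξ, hξn ▸ LinearMap.mkContinuous_norm_le _ hM _, fun i => ?_⟩
  have h1 : Φ (Finsupp.single i 1) = v i := by simp [Φ]
  have h2 : Γ (Finsupp.single i 1) = γ i := by simp [Γ]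
  let y : LinearMap.range Φ := ⟨v i, Finsupp.single i 1, h1⟩
  have h3 : ξ (v i) = Γ (σ y) := hξ y
  rw [h3, ← h2, ← sub_eq_zero, ← map_sub, ← abs_nonpos_iff]
  refine (hbd _).trans ?_
  rw [map_sub, hσ', h1]
  simp [y]

/-- A weakly-* measurable function with values in a separable dual is strongly measurable. -/
theorem stronglyMeasurable_of_dense_eval [TopologicalSpace.SeparableSpace (StrongDual ℝ E)]
    {v : ℕ → E} (hv : DenseRange v) {g : α → StrongDual ℝ E}
    (hg : ∀ i, Measurable fun t => g t (v i)) : StronglyMeasurable g := by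
  borelize (StrongDual ℝ E)
  have hball : ∀ (y : StrongDual ℝ E) (r : ℝ), 0 ≤ r → MeasurableSet (g ⁻¹' Metric.closedBall y r) := by
    intro y r hr
    -- The operator norm is tested on a dense sequence, which makes the preimage a countable
    -- intersection of measurable sets.
    have : g ⁻¹' Metric.closedBall y r = ⋂ i, {t | |g t (v i) - y (v i)| ≤ r * ‖v i‖} := by
      ext t
      simp only [mem_preimage, Metric.mem_closedBall, dist_eq_norm, mem_iInter, mem_ofPred_eq]
      constructor
      · intro h i
        exact (g t - y).le_of_opNorm_le h (v i)
      · intro h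
        refine (g t - y).opNorm_le_bound hr fun x => ?_
        exact hv.induction_on (p := fun x => ‖(g t - y) x‖ ≤ r * ‖x‖) x
          (isClosed_le (by fun_prop) (by fun_prop)) h
    rw [this]
    exact .iInter fun i => measurableSet_le ((hg i).sub_const _).abs measurable_const
  have : SecondCountableTopology (StrongDual ℝ E) := UniformSpace.secondCountable_of_separable _
  refine Measurable.stronglyMeasurable (measurable_of_isOpen fun U hU => ?_)
  let d := TopologicalSpace.denseSeq (StrongDual ℝ E)
  -- Separability of the dual writes an open set as a countable union of closed balls, so preimages
  -- of balls suffice.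
  have hU' : U = ⋃ (z : ℕ × ℚ) (_ : 0 ≤ (z.2 : ℝ) ∧ Metric.closedBall (d z.1) z.2 ⊆ U),
      Metric.closedBall (d z.1) z.2 := by
    refine Set.Subset.antisymm (fun y hy => ?_) (Set.iUnion₂_subset fun z hz => hz.2)
    obtain ⟨ε, hε, hb⟩ := Metric.isOpen_iff.1 hU y hy
    obtain ⟨q, hq0, hq⟩ := exists_rat_btwn (half_pos hε)
    obtain ⟨n, hn⟩ := (TopologicalSpace.denseRange_denseSeq (StrongDual ℝ E)).exists_dist_lt y hq0
    refine mem_iUnion₂.2 ⟨(n, q), ⟨hq0.le, fun w hw => hb ?_⟩, Metric.mem_closedBall.2 hn.le⟩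
    rw [Metric.mem_closedBall] at hw
    rw [Metric.mem_ball]
    have := dist_triangle w (d n) y
    rw [dist_comm (d n) y] at this
    change dist y (d n) < q at hn
    linarith
  rw [hU', preimage_iUnion₂]
  exact .iUnion fun z => .iUnion fun hz => hball _ _ hz.1

end LpDuality

/-! ### The dual of `L^p(μ; E)` as `L^{p'}(μ; E*)`. -/

section Representation

variable {α E : Type*} [MeasurableSpace α] {μ : Measure α} [NormedAddCommGroup E] [NormedSpace ℝ E]
  {p p' : ℝ≥0∞} [Fact (1 ≤ p)] [Fact (1 ≤ p')]

/-- The pairing of `L^{p'}(μ; E*)` with `L^p(μ; E)`. -/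
def dualPairing (μ : Measure α) (E : Type*) [NormedAddCommGroup E] [NormedSpace ℝ E]
    (p p' : ℝ≥0∞) [Fact (1 ≤ p)] [Fact (1 ≤ p')] [p.HolderConjugate p'] :
    Lp (StrongDual ℝ E) p' μ →L[ℝ] StrongDual ℝ (Lp E p μ) :=
  have : p'.HolderConjugate p := ENNReal.HolderConjugate.symm
  (ContinuousLinearMap.id ℝ (StrongDual ℝ E)).lpPairing μ p' p

theorem dualPairing_apply [p.HolderConjugate p'] (g : Lp (StrongDual ℝ E) p' μ) (f : Lp E p μ) :
    dualPairing μ E p p' g f = ∫ t, g t (f t) ∂μ :=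
  have : p'.HolderConjugate p := ENNReal.HolderConjugate.symm
  (ContinuousLinearMap.id ℝ (StrongDual ℝ E)).lpPairing_eq_integral g f

variable [IsFiniteMeasure μ]

/-- Simple functions are dense for `p ≠ ⊤`, and `x ↦ Λ(1_A x)` is continuous, so a dense sequence of
values determines the functional. -/
theorem dual_ext_indicatorLp (hp : p ≠ ⊤) {v : ℕ → E} (hv : DenseRange v)
    {Λ Λ' : StrongDual ℝ (Lp E p μ)}
    (h : ∀ i A (hA : MeasurableSet A), Λ (indicatorLp p μ E hA (v i)) = Λ' (indicatorLp p μ E hA (v i))) :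
    Λ = Λ' := by
  ext f
  refine Lp.induction hp (fun f => Λ f = Λ' f) ?_ ?_ (isClosed_eq Λ.continuous Λ'.continuous) f
  · intro c A hA hμ
    rw [Lp.simpleFunc.coe_indicatorConst]
    have hd : ∀ c, (Λ ∘L indicatorLp p μ E hA) c = (Λ' ∘L indicatorLp p μ E hA) c := fun c =>
      hv.induction_on c (isClosed_eq (ContinuousLinearMap.continuous _)
        (ContinuousLinearMap.continuous _)) fun i => h i A hA
    exact hd c
  · intro f g hf hg _ h1 h2
    rw [map_add, map_add, h1, h2]

/-- Functionals on `L^p(μ; E)` are represented by elements of `L^{p'}(μ; E*)` if `E*` is separable. -/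
theorem dualPairing_surjective [TopologicalSpace.SeparableSpace E]
    [TopologicalSpace.SeparableSpace (StrongDual ℝ E)] [p.HolderConjugate p'] (hp : p ≠ ⊤) (hp1 : 1 < p) :
    Function.Surjective (dualPairing μ E p p') := by
  intro Λ
  have : p'.HolderConjugate p := ENNReal.HolderConjugate.symm
  let v := TopologicalSpace.denseSeq E
  have hv : DenseRange v := TopologicalSpace.denseRange_denseSeq E
  choose k hkm hki hk using fun i => exists_density hp Λ (v i)
  -- Rational combinations of the dense vectors, with the matching combinations of densities: being
  -- countable, they share one exceptional null set.
  let e : (Σ n, Fin n → ℚ) → E := fun c => ∑ i, (c.2 i : ℝ) • v i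
  let hh : (Σ n, Fin n → ℚ) → α → ℝ := fun c t => ∑ i, (c.2 i : ℝ) * k i t
  have hhm : ∀ c, StronglyMeasurable (hh c) := fun c =>
    Finset.stronglyMeasurable_fun_sum _ fun i _ => (hkm i).const_mul _
  have hhi : ∀ c, Integrable (hh c) μ := fun c =>
    integrable_finsetSum _ fun i _ => (hki i).const_mul _
  have hhΛ : ∀ c A (hA : MeasurableSet A), Λ (indicatorLp p μ E hA (e c)) = ∫ t in A, hh c t ∂μ := by
    intro c A hA
    simp only [e, hh]
    rw [map_sum, map_sum, integral_finsetSum (μ := μ.restrict A) Finset.univ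
      (f := fun (i : Fin c.1) t => (c.2 i : ℝ) * k i t) fun i _ => ((hki i).const_mul _).integrableOn]
    refine Finset.sum_congr rfl fun i _ => ?_
    rw [map_smul, map_smul, hk, integral_const_mul, smul_eq_mul]
  -- When `e c = 0`, the normalising factor `‖e c‖⁻¹` is zero and the majorant says nothing about
  -- `hh c`; this case is settled separately.
  have hzero : ∀ᵐ t ∂μ, ∀ c, e c = 0 → hh c t = 0 := by
    rw [ae_all_iff]
    intro c
    by_cases hc : e c = 0
    · have : hh c =ᵐ[μ] 0 := by
        refine (hhi c).ae_eq_zero_of_forall_setIntegral_eq_zero fun A hA _ => ?_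
        rw [← hhΛ c A hA, hc, map_zero, map_zero]
      filter_upwards [this] with t ht _ using ht
    · exact Eventually.of_forall fun t h => absurd h hc
  obtain ⟨en, hen⟩ := exists_surjective_nat (Σ n, Fin n → ℚ)
  obtain ⟨G, hG, hGle⟩ := exists_memLp_majorant (p' := p') hp hp1 Λ
    (x := fun j => ‖e (en j)‖⁻¹ • e (en j)) (k := fun j t => ‖e (en j)‖⁻¹ * hh (en j) t)
    (fun j => by
      rw [norm_smul, norm_inv, norm_norm]
      exact inv_mul_le_one)
    (fun j => (hhm _).const_mul _) (fun j => (hhi _).const_mul _)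
    (fun j A hA => by rw [map_smul, map_smul, hhΛ, integral_const_mul, smul_eq_mul])
  have hgood : ∀ᵐ t ∂μ, 0 ≤ G t ∧ ∀ c, |hh c t| ≤ G t * ‖e c‖ := by
    filter_upwards [hGle, hzero] with t h1 h2
    refine ⟨(abs_nonneg _).trans (h1 0), fun c => ?_⟩
    obtain ⟨j, rfl⟩ := hen c
    by_cases hc : e (en j) = 0
    · simp [h2 _ hc, hc]
    · have h3 := h1 j
      have h4 : 0 < ‖e (en j)‖ := norm_pos_iff.2 hc
      rw [abs_mul, abs_of_nonneg (by positivity), inv_mul_le_iff₀ h4, mul_comm] at h3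
      exact h3
  -- The representative is set to zero on a measurable null set, so that the formula for its values
  -- on the dense sequence holds everywhere.
  obtain ⟨S, hSsub, hSm, hS0⟩ := exists_measurable_superset_of_null (ae_iff.1 hgood)
  have hSgood : ∀ t ∉ S, 0 ≤ G t ∧ ∀ c, |hh c t| ≤ G t * ‖e c‖ := by
    intro t ht
    by_contra h
    exact ht (hSsub h)
  have hex : ∀ t, ∃ ξ : StrongDual ℝ E, ‖ξ‖ ≤ |G t| ∧ ∀ i, ξ (v i) = Sᶜ.indicator (k i) t := by
    intro t
    by_cases ht : t ∈ S
    · exact ⟨0, by simp, fun i => by simp [ht]⟩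
    · obtain ⟨h0, h1⟩ := hSgood t ht
      obtain ⟨ξ, hξ, hξv⟩ := exists_dual_of_forall_rat_le v (fun i => k i t) h0 fun n c => h1 ⟨n, c⟩
      exact ⟨ξ, hξ.trans (le_abs_self _), fun i => by simp [ht, hξv]⟩
  -- The choice is made pointwise. Measurability is recovered afterwards from the values on the
  -- dense sequence, which are measurable in `t`.
  choose g hgn hgv using hex
  have hgm : StronglyMeasurable g := by
    refine stronglyMeasurable_of_dense_eval hv fun i => ?_
    simp_rw [hgv]
    exact ((hkm i).measurable).indicator hSm.compl
  have hgLp : MemLp g p' μ := hG.of_le hgm.aestronglyMeasurable (Eventually.of_forall hgn)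
  refine ⟨hgLp.toLp g, dual_ext_indicatorLp hp hv fun i A hA => ?_⟩
  rw [dualPairing_apply, hk, ← integral_indicator hA]
  refine integral_congr_ae ?_
  have hS' : ∀ᵐ t ∂μ, t ∉ S := measure_eq_zero_iff_ae_notMem.1 hS0
  filter_upwards [hgLp.coeFn_toLp, hS',
    indicatorConstLp_coeFn (p := p) (hs := hA) (hμs := measure_ne_top μ _) (c := v i)] with t h1 h2 h3
  rw [h1, indicatorLp_apply, h3]
  by_cases ht : t ∈ A <;> simp [ht, hgv, h2]

end Representation

/-! ### Separability of a space from that of its dual. -/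

section Separability

variable {X : Type*} [NormedAddCommGroup X] [NormedSpace ℝ X]

theorem eq_top_of_forall_dual_eq_zero (p : Submodule ℝ X) (hp : IsClosed (p : Set X))
    (h : ∀ f : StrongDual ℝ X, (∀ x ∈ p, f x = 0) → f = 0) : p = ⊤ := by
  by_contra hne
  obtain ⟨x, hx⟩ := SetLike.exists_not_mem_of_ne_top p hne rfl
  obtain ⟨f, u, hu, hux⟩ := geometric_hahn_banach_closed_point p.convex hp hx
  have h0 : ∀ y ∈ p, f y = 0 := by
    intro y hy
    by_contra hfy
    -- The scaling gives `f` the value `u + 1` on the subspace, against its upper bound `u`.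
    have := hu (((u + 1) / f y) • y) (p.smul_mem _ hy)
    rw [map_smul, smul_eq_mul, div_mul_cancel₀ _ hfy] at this
    linarith
  have := hu 0 p.zero_mem
  rw [h f h0] at this hux
  simp at this hux
  linarith

/-- Take vectors in the unit ball that nearly norm a dense sequence of functionals. A functional
vanishing on all of them cannot be approximated by that sequence unless it is zero, so by
Hahn-Banach their span is dense. -/
theorem separableSpace_of_dual [TopologicalSpace.SeparableSpace (StrongDual ℝ X)] :
    TopologicalSpace.SeparableSpace X := by
  let f := TopologicalSpace.denseSeq (StrongDual ℝ X)
  have hx : ∀ n, ∃ x : X, ‖x‖ ≤ 1 ∧ ‖f n‖ / 2 ≤ ‖f n x‖ := by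
    intro n
    by_contra! h
    have h1 : ‖f n‖ ≤ ‖f n‖ / 2 := by
      refine (f n).opNorm_le_of_unit_norm (by positivity) fun x hx => (h x hx.le).le
    have h2 : ‖f n‖ = 0 := by linarith [norm_nonneg (f n)]
    have := h 0 (by simp)
    simp [h2] at this
  choose x hx1 hx2 using hx
  let S : Submodule ℝ X := Submodule.span ℝ (range x)
  have hS : S.topologicalClosure = ⊤ := by
    refine eq_top_of_forall_dual_eq_zero _ S.isClosed_topologicalClosure fun g hg => ?_
    rw [← norm_eq_zero]
    by_contra hne
    have hpos : 0 < ‖g‖ := lt_of_le_of_ne (norm_nonneg _) (Ne.symm hne)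
    -- With `‖f n‖ ≤ 2 ‖g - f n‖` the triangle inequality gives `‖g‖ ≤ 3 ‖g - f n‖`; a distance
    -- below `‖g‖ / 4` is then contradictory.
    obtain ⟨n, hn⟩ := (TopologicalSpace.denseRange_denseSeq (StrongDual ℝ X)).exists_dist_lt g
      (show 0 < ‖g‖ / 4 by positivity)
    change dist g (f n) < _ at hn
    rw [dist_eq_norm] at hn
    have h1 : ‖f n (x n)‖ ≤ ‖g - f n‖ := by
      have h2 : g (x n) = 0 := hg _ (S.le_topologicalClosure (Submodule.subset_span ⟨n, rfl⟩))
      have h3 := (g - f n).le_opNorm_of_le (hx1 n)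
      rw [sub_apply, h2, zero_sub, norm_neg, mul_one] at h3
      exact h3
    have h4 : ‖g‖ ≤ ‖g - f n‖ + ‖f n‖ := by
      simpa using norm_add_le (g - f n) (f n)
    linarith [hx2 n]
  have h1 : TopologicalSpace.IsSeparable (S : Set X) :=
    (countable_range x).isSeparable.span
  have h2 := h1.closure
  rw [← Submodule.topologicalClosure_coe, hS] at h2
  exact TopologicalSpace.isSeparable_univ_iff.1 h2

/-- The bidual is a continuous image of `X`, hence separable, and separability descends from the
bidual to the dual. -/
theorem IsReflexive.separableSpace_dual (h : IsReflexive X) [TopologicalSpace.SeparableSpace X] :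
    TopologicalSpace.SeparableSpace (StrongDual ℝ X) := by
  have : TopologicalSpace.SeparableSpace (StrongDual ℝ (StrongDual ℝ X)) :=
    h.denseRange.separableSpace (NormedSpace.inclusionInDoubleDual ℝ X).continuous
  exact separableSpace_of_dual

end Separability

/-! ### Weak sequential compactness in Bochner spaces. -/

section WeakCompactness

variable {α V : Type*} [MeasurableSpace α] {μ : Measure α} [NormedAddCommGroup V] [NormedSpace ℝ V]
  {p : ℝ≥0∞} [Fact (1 ≤ p)] [IsFiniteMeasure μ]

/-- Bounded sequences in `L^p(μ; V)`, `1 < p < ∞`, have weakly convergent subsequences if `V` is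
reflexive and separable. -/
theorem Lp.exists_weakTendsto_subseq [IsSeparable μ] (hV : IsReflexive V)
    [TopologicalSpace.SeparableSpace V] (hp1 : 1 < p) (hp : p ≠ ⊤) (f : ℕ → Lp V p μ) {M : ℝ}
    (hf : ∀ n, ‖f n‖ ≤ M) :
    ∃ (a : Lp V p μ) (φ : ℕ → ℕ), StrictMono φ ∧ WeakTendsto (f ∘ φ) a := by
  have hVd := hV.separableSpace_dual
  have hVdd : TopologicalSpace.SeparableSpace (StrongDual ℝ (StrongDual ℝ V)) :=
    hV.denseRange.separableSpace (NormedSpace.inclusionInDoubleDual ℝ V).continuous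
  let p' := p.conjExponent
  have hp'1 : 1 < p' := by
    refine ENNReal.lt_add_right ENNReal.one_ne_top (ENNReal.inv_ne_zero.2 ?_)
    exact ENNReal.sub_ne_top hp
  have hp' : p' ≠ ⊤ := by
    refine ENNReal.add_ne_top.2 ⟨ENNReal.one_ne_top, ENNReal.inv_ne_top.2 ?_⟩
    exact (tsub_pos_of_lt hp1).ne'
  have hF : Fact (1 ≤ p') := ⟨hp'1.le⟩
  have hF' : Fact (p' ≠ ⊤) := ⟨hp'⟩
  have hconj : p.HolderConjugate p' := inferInstance
  have hconj' : p'.HolderConjugate p := ENNReal.HolderConjugate.symm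
  have hsep : SecondCountableTopology (Lp (StrongDual ℝ V) p' μ) := inferInstance
  let P := dualPairing μ V p p'
  -- The `f n` act as functionals on the separable space `L^{p'}(μ; V*)`, where bounded sequences of
  -- functionals have weak-* convergent subsequences.
  obtain ⟨Ψ, -, φ, hφ, hΨ⟩ := WeakDual.isSeqCompact_closedBall ℝ (Lp (StrongDual ℝ V) p' μ) 0 (‖P‖ * M)
    (x := fun n => StrongDual.toWeakDual (P.flip (f n))) (fun n => by
      rw [mem_preimage, mem_closedBall_zero_iff]
      refine (P.flip.le_opNorm _).trans ?_
      rw [ContinuousLinearMap.opNorm_flip]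
      gcongr
      exact hf n)
  -- The limit functional is represented in `L^p(μ; V**)`; reflexivity then brings it back to `V`
  -- pointwise.
  obtain ⟨F, hF⟩ := dualPairing_surjective (μ := μ) (E := StrongDual ℝ V) (p := p') (p' := p) hp' hp'1
    (WeakDual.toStrongDual Ψ)
  let J : V ≃ₗᵢ[ℝ] StrongDual ℝ (StrongDual ℝ V) :=
    LinearIsometryEquiv.ofSurjective (NormedSpace.inclusionInDoubleDualLi ℝ) hV
  let a : Lp V p μ := (J.symm.toContinuousLinearEquiv : _ →L[ℝ] V).compLp F
  refine ⟨a, φ, hφ, fun Λ => ?_⟩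
  obtain ⟨g, rfl⟩ := dualPairing_surjective (p' := p') hp hp1 Λ
  have h1 : P g a = Ψ g := by
    change P g a = WeakDual.toStrongDual Ψ g
    rw [← hF, dualPairing_apply, dualPairing_apply]
    refine integral_congr_ae ?_
    filter_upwards [(J.symm.toContinuousLinearEquiv : _ →L[ℝ] V).coeFn_compLp F] with t ht
    have h2 : J (a t) = F t := by
      rw [ht]
      exact J.apply_symm_apply _
    rw [← h2]
    rfl
  change Tendsto _ _ (𝓝 (P g a))
  rw [h1]
  have h2 : Tendsto (fun n => P.flip (f (φ n)) g) atTop (𝓝 (Ψ g)) :=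
    ((WeakDual.eval_continuous g).tendsto Ψ).comp hΨ
  simp only [ContinuousLinearMap.flip_apply] at h2
  exact h2

end WeakCompactness

/-! ### Weak convergence, compact operators and equivalent norms. -/

section WeakConvergence

variable {X Z : Type*} [NormedAddCommGroup X] [NormedSpace ℝ X] [NormedAddCommGroup Z] [NormedSpace ℝ Z]

theorem WeakTendsto.map {x : ℕ → X} {a : X} (h : WeakTendsto x a) (L : X →L[ℝ] Z) :
    WeakTendsto (fun n => L (x n)) (L a) := fun Λ => h (Λ ∘L L)

theorem WeakTendsto.comp {x : ℕ → X} {a : X} (h : WeakTendsto x a) {φ : ℕ → ℕ} (hφ : StrictMono φ) :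
    WeakTendsto (x ∘ φ) a := fun Λ => (h Λ).comp hφ.tendsto_atTop

theorem WeakTendsto.sub_const {x : ℕ → X} {a : X} (h : WeakTendsto x a) :
    WeakTendsto (fun n => x n - a) 0 := fun Λ => by
  have := (h Λ).sub_const (Λ a)
  simpa using this

theorem WeakTendsto.unique {x : ℕ → X} {a b : X} (ha : WeakTendsto x a) (hb : WeakTendsto x b) :
    a = b := by
  by_contra h
  obtain ⟨f, hf⟩ := SeparatingDual.exists_ne_zero (R := ℝ) (sub_ne_zero.2 h)
  apply hf
  rw [map_sub, sub_eq_zero]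
  exact tendsto_nhds_unique (ha f) (hb f)

theorem weakTendsto_of_tendsto {x : ℕ → X} {a : X} (h : Tendsto x atTop (𝓝 a)) : WeakTendsto x a :=
  fun Λ => (Λ.continuous.tendsto a).comp h

/-- Compact operators map bounded weak null sequences to null sequences. -/
theorem tendsto_zero_of_compact {L : X →L[ℝ] Z} (hL : IsCompactOperator L) {x : ℕ → X} {M : ℝ}
    (hM : ∀ n, ‖x n‖ ≤ M) (hx : WeakTendsto x 0) : Tendsto (fun n => L (x n)) atTop (𝓝 0) := by
  obtain ⟨K, hK, hsub⟩ := hL.image_closedBall_subset_compact (f := (L : X →ₗ[ℝ] Z)) M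
  have hmem : ∀ n, L (x n) ∈ K := fun n => hsub ⟨x n, by simpa using hM n, rfl⟩
  refine tendsto_of_subseq_tendsto fun ns hns => ?_
  obtain ⟨b, -, φ, hφ, hb⟩ := hK.tendsto_subseq fun n => hmem (ns n)
  have h1 : b = 0 := by
    refine (weakTendsto_of_tendsto hb).unique fun Λ => ?_
    have h2 := hx (Λ ∘L L)
    simp only [map_zero] at h2 ⊢
    exact h2.comp (hns.comp hφ.tendsto_atTop)
  exact ⟨φ, h1 ▸ hb⟩

/-- Every equivalent norm is weakly sequentially lower semicontinuous. -/
theorem IsEquivalentNorm.eventually_lt {N : Seminorm ℝ X} (hN : IsEquivalentNorm N) {x : ℕ → X} {a : X}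
    (h : WeakTendsto x a) {e : ℝ} (he : e < N a) : ∀ᶠ n in atTop, e < N (x n) := by
  obtain ⟨c, C, hc, hC, hcC⟩ := hN
  -- A functional norming `a` with respect to `N`, from Hahn-Banach with `N` as dominating sublinear
  -- functional; continuity comes from `N ≤ C ‖·‖`.
  obtain ⟨Λ, hΛa, hΛ⟩ : ∃ Λ : StrongDual ℝ X, Λ a = N a ∧ ∀ x, Λ x ≤ N x := by
    by_cases ha : a = 0
    · exact ⟨0, by simp [ha], fun x => by simp⟩
    · let f : X →ₗ.[ℝ] ℝ := LinearPMap.mkSpanSingleton a (N a) ha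
      obtain ⟨g, hg, hgN⟩ := exists_extension_of_le_sublinear f N
        (fun c hc x => by rw [map_smul_eq_mul, Real.norm_of_nonneg hc.le])
        (fun x y => map_add_le_add N x y) (by
          rintro ⟨x, hx⟩
          obtain ⟨t, rfl⟩ := Submodule.mem_span_singleton.1 hx
          refine (LinearPMap.mkSpanSingleton'_apply _ _ _ _ hx).trans_le ?_
          change t * N a ≤ N (t • a)
          rw [map_smul_eq_mul, Real.norm_eq_abs]
          gcongr
          exact le_abs_self t)
      refine ⟨g.mkContinuous C fun x => ?_, ?_, hgN⟩
      · rw [Real.norm_eq_abs, abs_le']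
        refine ⟨(hgN x).trans (hcC x).2, ?_⟩
        rw [← map_neg]
        refine (hgN (-x)).trans ?_
        rw [map_neg_eq_map]
        exact (hcC x).2
      · change g a = N a
        have := hg ⟨a, Submodule.mem_span_singleton_self a⟩
        rw [this]
        exact LinearPMap.mkSpanSingleton_apply ℝ ℝ ha (N a)
  have h1 := h Λ
  rw [hΛa] at h1
  filter_upwards [h1.eventually_const_lt he] with n hn
  exact hn.trans_le (hΛ _)

end WeakConvergence

/-! ### Weighted time integrals as bounded operators. -/

section WeightedIntegral

variable {α V : Type*} [MeasurableSpace α] {μ : Measure α} [NormedAddCommGroup V] [NormedSpace ℝ V]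
  [CompleteSpace V] {p : ℝ≥0∞} [Fact (1 ≤ p)]

/-- The operator `f ↦ ∫ φ f` on `L^p(μ; V)`. -/
def weightedIntegral (p : ℝ≥0∞) [Fact (1 ≤ p)] (V : Type*) [NormedAddCommGroup V] [NormedSpace ℝ V]
    [CompleteSpace V] {φ : α → ℝ} (hφ : MemLp φ p.conjExponent μ) : Lp V p μ →L[ℝ] V :=
  have : Fact (1 ≤ p.conjExponent) := ⟨le_self_add⟩
  have : p.conjExponent.HolderConjugate p := ENNReal.HolderConjugate.symm
  (ContinuousLinearMap.lsmul ℝ ℝ : ℝ →L[ℝ] V →L[ℝ] V).lpPairing μ p.conjExponent p (hφ.toLp φ)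

theorem weightedIntegral_apply {φ : α → ℝ} (hφ : MemLp φ p.conjExponent μ) (f : Lp V p μ) :
    weightedIntegral p V hφ f = ∫ t, φ t • f t ∂μ := by
  have : Fact (1 ≤ p.conjExponent) := ⟨le_self_add⟩
  have : p.conjExponent.HolderConjugate p := ENNReal.HolderConjugate.symm
  refine (ContinuousLinearMap.lpPairing_eq_integral _ _ _).trans (integral_congr_ae ?_)
  filter_upwards [hφ.coeFn_toLp] with t ht
  rw [ht]
  rfl

theorem memLp_of_continuous_hasCompactSupport {μ : Measure ℝ} [IsFiniteMeasure μ] {q : ℝ≥0∞} {φ : ℝ → ℝ}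
    (hc : Continuous φ) (hs : HasCompactSupport φ) : MemLp φ q μ := by
  obtain ⟨C, hC⟩ := hs.exists_bound_of_continuous hc
  exact MemLp.of_bound hc.aestronglyMeasurable C (Eventually.of_forall hC)

end WeightedIntegral

/-! ### Weak compactness of the state space. -/

namespace StateSpace

variable {V Vt : Type*} [NormedAddCommGroup V] [NormedSpace ℝ V]
  [NormedAddCommGroup Vt] [NormedSpace ℝ Vt] {T : ℝ} {p : ℝ≥0∞} [Fact (1 ≤ p)] {ι : V →L[ℝ] Vt}

/-- The state as a continuous linear function of the element of the state space. -/
def stateL : StateSpace T p ι →L[ℝ] Lp V p (timeMeasure T) :=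
  ContinuousLinearMap.fst ℝ _ _ ∘L (StateSpace T p ι).subtypeL

/-- The time derivative as a continuous linear function of the element of the state space. -/
def timeDerivL : StateSpace T p ι →L[ℝ] Lp Vt p (timeMeasure T) :=
  ContinuousLinearMap.snd ℝ _ _ ∘L (StateSpace T p ι).subtypeL

theorem norm_state_le (u : StateSpace T p ι) : ‖state u‖ ≤ ‖u‖ := norm_fst_le u.1

theorem norm_timeDeriv_le (u : StateSpace T p ι) : ‖timeDeriv u‖ ≤ ‖u‖ := norm_snd_le u.1

/-- Weak limits are extracted for the state and for its derivative separately. The defining relation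
survives because, for a fixed test function, both of its sides are bounded linear operators of these
two components. -/
theorem exists_weakTendsto_subseq [CompleteSpace V] [CompleteSpace Vt]
    (hV : IsReflexive V) (hVt : IsReflexive Vt) [TopologicalSpace.SeparableSpace V]
    [TopologicalSpace.SeparableSpace Vt] (hp1 : 1 < p) (hp : p ≠ ⊤) (u : ℕ → StateSpace T p ι) {M : ℝ}
    (hu : ∀ n, ‖u n‖ ≤ M) :
    ∃ (a : StateSpace T p ι) (φ : ℕ → ℕ), StrictMono φ ∧ WeakTendsto (u ∘ φ) a := by
  obtain ⟨a, φ, hφ, ha⟩ := Lp.exists_weakTendsto_subseq hV hp1 hp (fun n => state (u n))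
    fun n => (norm_state_le _).trans (hu n)
  obtain ⟨b, ψ, hψ, hb⟩ := Lp.exists_weakTendsto_subseq hVt hp1 hp (fun n => timeDeriv (u (φ n)))
    fun n => (norm_timeDeriv_le _).trans (hu _)
  have ha' := ha.comp hψ
  have hmem : (a, b) ∈ StateSpace T p ι := by
    intro η hη
    have hd : Continuous (deriv η) := hη.smooth.continuous_deriv (by simp)
    have h1 : MemLp η p.conjExponent (timeMeasure T) :=
      memLp_of_continuous_hasCompactSupport hη.smooth.continuous hη.hasCompactSupport
    have h2 : MemLp (deriv η) p.conjExponent (timeMeasure T) :=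
      memLp_of_continuous_hasCompactSupport hd hη.hasCompactSupport.deriv
    have key : ∀ f : Lp V p (timeMeasure T), ∫ t in Ioo 0 T, deriv η t • ι (f t) =
        ι (weightedIntegral p V h2 f) := by
      intro f
      rw [weightedIntegral_apply, ← ι.integral_comp_comm
        (integrable_test_mul f hd hη.hasCompactSupport.deriv)]
      simp
    have h3 := (ha'.map (weightedIntegral p V h2)).map ι
    have h4 := hb.map (weightedIntegral p Vt h1)
    change ∫ t in Ioo 0 T, deriv η t • ι (a t) = - ∫ t in Ioo 0 T, η t • b t
    rw [key a, ← weightedIntegral_apply h1]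
    refine h3.unique fun Λ => ?_
    rw [map_neg]
    refine (h4 Λ).neg.congr fun n => ?_
    rw [← map_neg]
    congr 1
    have h5 := (u (φ (ψ n))).2 η hη
    have h6 := key (state (u (φ (ψ n))))
    have h7 := weightedIntegral_apply h1 (timeDeriv (u (φ (ψ n))))
    simp only [Function.comp]
    rw [← h6, h7]
    exact h5.symm
  refine ⟨⟨(a, b), hmem⟩, φ ∘ ψ, hφ.comp hψ, fun Λ => ?_⟩
  -- A functional on the state space extends to the product of the two Bochner spaces, where it
  -- splits into one functional for each component.
  obtain ⟨g, hg, -⟩ := exists_extension_norm_eq (StateSpace T p ι) Λ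
  have hsplit : ∀ z : StateSpace T p ι, Λ z =
      g.comp (ContinuousLinearMap.inl ℝ _ _) z.1.1 + g.comp (ContinuousLinearMap.inr ℝ _ _) z.1.2 := by
    intro z
    rw [← hg, ContinuousLinearMap.comp_apply, ContinuousLinearMap.comp_apply, ← map_add]
    simp
  simp_rw [hsplit]
  exact (ha' _).add (hb _)

end StateSpace

/-! ### Weak derivatives in time: du Bois-Reymond and integration by parts. -/

section TimeRegularity

variable {F : Type*} [NormedAddCommGroup F] [NormedSpace ℝ F] {T : ℝ}

/-- A test function with vanishing integral is the derivative of a test function. -/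
theorem IsTestFunction.exists_primitive {χ : ℝ → ℝ} (hT : 0 < T) (hχ : IsTestFunction (Ioo 0 T) χ)
    (h0 : ∫ t, χ t = 0) : ∃ Φ : ℝ → ℝ, IsTestFunction (Ioo 0 T) Φ ∧ deriv Φ = χ := by
  have hc : Continuous χ := hχ.smooth.continuous
  obtain ⟨a, b, ha, hb, hab⟩ : ∃ a b, 0 < a ∧ b < T ∧ tsupport χ ⊆ Icc a b := by
    -- Inserting the midpoint keeps the set nonempty when `χ = 0`, so its infimum and supremum are
    -- points of `(0, T)`.
    have hK : IsCompact (insert (T / 2) (tsupport χ)) := hχ.hasCompactSupport.insert _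
    have hne : (insert (T / 2) (tsupport χ)).Nonempty := ⟨_, mem_insert _ _⟩
    have hsub : insert (T / 2) (tsupport χ) ⊆ Ioo 0 T :=
      insert_subset ⟨by linarith, by linarith⟩ hχ.tsupport_subset
    exact ⟨_, _, (hsub (hK.sInf_mem hne)).1, (hsub (hK.sSup_mem hne)).2, fun t ht =>
      ⟨csInf_le hK.bddBelow (mem_insert_of_mem _ ht), le_csSup hK.bddAbove (mem_insert_of_mem _ ht)⟩⟩
  let Φ : ℝ → ℝ := fun t => ∫ s in (0 : ℝ)..t, χ s
  have hd : ∀ t, HasDerivAt Φ (χ t) t := fun t =>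
    (hc.integral_hasStrictDerivAt 0 t).hasDerivAt
  have hderiv : deriv Φ = χ := funext fun t => (hd t).deriv
  have hzero : ∀ t, t ∉ Icc a b → χ t = 0 := fun t ht =>
    image_eq_zero_of_notMem_tsupport fun h => ht (hab h)
  have hsupp : ∀ t, t ∉ Icc a b → Φ t = 0 := by
    intro t ht
    rw [mem_Icc, not_and_or, not_le, not_le] at ht
    rcases ht with ht | ht
    · refine intervalIntegral.integral_zero_ae (Eventually.of_forall fun s hs => hzero s fun h => ?_)
      rcases le_total 0 t with h1 | h1
      · rw [uIoc_of_le h1] at hs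
        linarith [hs.2, h.1]
      · rw [uIoc_of_ge h1] at hs
        linarith [hs.2, h.1]
    · change ∫ s in (0 : ℝ)..t, χ s = 0
      rw [intervalIntegral.integral_eq_integral_of_support_subset, h0]
      intro s hs
      have := hab (subset_tsupport χ hs)
      exact ⟨by linarith [this.1], by linarith [this.2]⟩
  have hts : tsupport Φ ⊆ Icc a b :=
    closure_minimal (fun t ht => by_contra fun h => ht (hsupp t h)) isClosed_Icc
  refine ⟨Φ, ⟨?_, HasCompactSupport.of_support_subset_isCompact (isCompact_Icc (a := a) (b := b))
    ((subset_tsupport _).trans hts), fun t ht => ⟨by linarith [(hts ht).1], by linarith [(hts ht).2]⟩⟩, hderiv⟩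
  rw [contDiff_infty_iff_deriv, hderiv]
  exact ⟨fun t => (hd t).differentiableAt, hχ.smooth⟩

theorem IsTestFunction.setIntegral_smul {O : Set ℝ} {ψ : ℝ → ℝ} (hψ : IsTestFunction O ψ) (g : ℝ → F) :
    ∫ t in O, ψ t • g t = ∫ t, ψ t • g t :=
  setIntegral_eq_integral_of_forall_compl_eq_zero fun t ht => by
    rw [image_eq_zero_of_notMem_tsupport fun h => ht (hψ.tsupport_subset h), zero_smul]

theorem IsTestFunction.integrable_smul {ψ : ℝ → ℝ} {O : Set ℝ} (hψ : IsTestFunction O ψ) {g : ℝ → F}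
    (hg : IntegrableOn g O) : IntegrableOn (fun t => ψ t • g t) O := by
  obtain ⟨C, hC⟩ := hψ.hasCompactSupport.exists_bound_of_continuous hψ.smooth.continuous
  exact hg.bdd_smul C hψ.smooth.continuous.aestronglyMeasurable (Eventually.of_forall hC)

variable [CompleteSpace F]

/-- The lemma of du Bois-Reymond. -/
theorem ae_eq_const_of_integral_deriv_smul (hT : 0 < T) {g : ℝ → F} (hg : IntegrableOn g (Ioo 0 T))
    (h : ∀ φ : ℝ → ℝ, IsTestFunction (Ioo 0 T) φ → ∫ t in Ioo 0 T, deriv φ t • g t = 0) :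
    ∃ c : F, ∀ᵐ t ∂timeMeasure T, g t = c := by
  let B : ContDiffBump (T / 2) := ⟨T / 8, T / 4, by linarith, by linarith⟩
  let η : ℝ → ℝ := B.normed volume
  have hη : IsTestFunction (Ioo 0 T) η := by
    refine ⟨B.contDiff_normed, B.hasCompactSupport_normed, ?_⟩
    rw [B.tsupport_normed_eq, Real.closedBall_eq_Icc]
    intro t ht
    have h1 : T / 2 - T / 4 ≤ t := ht.1
    have h2 : t ≤ T / 2 + T / 4 := ht.2
    exact ⟨by linarith, by linarith⟩
  have hη1 : ∫ t, η t = 1 := B.integral_normed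
  let c : F := ∫ t in Ioo 0 T, η t • g t
  refine ⟨c, ?_⟩
  have hgc : IntegrableOn (fun t => g t - c) (Ioo 0 T) := hg.sub (integrable_const c)
  have := isOpen_Ioo.ae_eq_zero_of_integral_contDiff_smul_eq_zero (U := Ioo 0 T) (μ := volume)
    (f := fun t => g t - c) hgc.locallyIntegrableOn ?_
  · rw [ae_restrict_iff' measurableSet_Ioo]
    filter_upwards [this] with t ht h1 using sub_eq_zero.1 (ht h1)
  intro ψ hψ1 hψ2 hψ3
  have hψ : IsTestFunction (Ioo 0 T) ψ := ⟨hψ1, hψ2, hψ3⟩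
  have hψi : Integrable ψ := hψ1.continuous.integrable_of_hasCompactSupport hψ2
  have hηi : Integrable η := hη.smooth.continuous.integrable_of_hasCompactSupport hη.hasCompactSupport
  -- Subtracting the right multiple of the normalised bump makes the integral vanish, so `χ` is the
  -- derivative of a test function.
  let χ : ℝ → ℝ := fun t => ψ t - (∫ s, ψ s) * η t
  have hχ : IsTestFunction (Ioo 0 T) χ := by
    refine ⟨hψ1.sub (contDiff_const.mul hη.smooth), hψ2.sub hη.hasCompactSupport.mul_left, ?_⟩
    refine (tsupport_sub _ _).trans (union_subset hψ3 ?_)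
    exact (closure_mono (Function.support_mul_subset_right _ _)).trans hη.tsupport_subset
  obtain ⟨Φ, hΦ, hΦχ⟩ := hχ.exists_primitive hT (by
    rw [integral_sub hψi (hηi.const_mul _), integral_const_mul, hη1, mul_one, sub_self])
  have h1 := h Φ hΦ
  rw [hΦχ] at h1
  have h2 : ∀ t, χ t • g t = ψ t • g t - (∫ s, ψ s) • (η t • g t) := fun t => by
    simp only [χ, sub_smul, mul_smul]
  simp_rw [h2] at h1
  have h4 : ∫ t in Ioo 0 T, (ψ t • g t - (∫ s, ψ s) • (η t • g t)) =
      (∫ t in Ioo 0 T, ψ t • g t) - ∫ t in Ioo 0 T, (∫ s, ψ s) • (η t • g t) :=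
    integral_sub (hψ.integrable_smul hg) ((hη.integrable_smul hg).smul _)
  rw [h4, integral_smul] at h1
  rw [← hψ.setIntegral_smul]
  simp_rw [smul_sub]
  rw [integral_sub (hψ.integrable_smul hg) (hψi.integrableOn.smul_const c), integral_smul_const]
  have h3 : ∫ t in Ioo 0 T, ψ t = ∫ t, ψ t := by
    simpa using hψ.setIntegral_smul (fun _ => (1 : ℝ))
  rw [h3]
  exact h1

/-- Integration by parts against the primitive of an integrable function. -/
theorem integral_deriv_smul_primitive {w : ℝ → F} (hw : IntegrableOn w (Ioo 0 T))
    {φ : ℝ → ℝ} (hφ : IsTestFunction (Ioo 0 T) φ) :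
    ∫ t in Ioo 0 T, deriv φ t • ∫ s in Ioo 0 t, w s = - ∫ t in Ioo 0 T, φ t • w t := by
  have hd : Continuous (deriv φ) := hφ.smooth.continuous_deriv (by simp)
  have hdi : IntegrableOn (deriv φ) (Ioo 0 T) :=
    (hd.integrable_of_hasCompactSupport hφ.hasCompactSupport.deriv).integrableOn
  -- The triangle `s < t` is encoded as an indicator on the square, in preparation for Fubini.
  have h1 : ∀ t ∈ Ioo 0 T, deriv φ t • ∫ s in Ioo 0 t, w s =
      ∫ s in Ioo 0 T, {z : ℝ × ℝ | z.2 < z.1}.indicator (fun z => deriv φ z.1 • w z.2) (t, s) := by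
    intro t ht
    have h2 : ∀ s, {z : ℝ × ℝ | z.2 < z.1}.indicator (fun z => deriv φ z.1 • w z.2) (t, s) =
        (Iio t).indicator (fun s => deriv φ t • w s) s := fun s => by
      by_cases hs : s < t <;> simp [hs]
    simp_rw [h2]
    rw [integral_indicator measurableSet_Iio, Measure.restrict_restrict measurableSet_Iio,
      integral_smul]
    congr 3
    ext s
    simp only [mem_inter_iff, mem_Iio, mem_Ioo]
    constructor
    · exact fun h => ⟨h.2, h.1, h.2.trans ht.2⟩
    · exact fun h => ⟨h.2.1, h.1⟩
  rw [setIntegral_congr_fun measurableSet_Ioo h1, integral_integral_swap]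
  · rw [← integral_neg]
    refine setIntegral_congr_fun measurableSet_Ioo fun s hs => ?_
    have h2 : ∀ t, {z : ℝ × ℝ | z.2 < z.1}.indicator (fun z => deriv φ z.1 • w z.2) (t, s) =
        (Ioi s).indicator (fun t => deriv φ t) t • w s := fun t => by
      by_cases ht : s < t <;> simp [ht]
    simp_rw [h2]
    rw [integral_smul_const, integral_indicator measurableSet_Ioi,
      Measure.restrict_restrict measurableSet_Ioi]
    have h3 : Ioi s ∩ Ioo 0 T = Ioo s T := by
      ext t
      simp only [mem_inter_iff, mem_Ioi, mem_Ioo]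
      exact ⟨fun h => ⟨h.1, h.2.2⟩, fun h => ⟨h.1, hs.1.trans h.1, h.2⟩⟩
    have h4 : φ T = 0 := image_eq_zero_of_notMem_tsupport fun h =>
      lt_irrefl _ (hφ.tsupport_subset h).2
    rw [h3, ← integral_Ioc_eq_integral_Ioo, ← intervalIntegral.integral_of_le hs.2.le,
      intervalIntegral.integral_deriv_eq_sub
        (fun t _ => (hφ.smooth.differentiable (by simp)).differentiableAt)
        (hd.intervalIntegrable _ _), h4, zero_sub, neg_smul]
  · exact (hdi.smul_prod hw).indicator (measurableSet_lt measurable_snd measurable_fst)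

end TimeRegularity

/-! ### Time continuity in `Ṽ` and pointwise convergence under compact operators. -/

namespace StateSpace

variable {V Vt : Type*} [NormedAddCommGroup V] [NormedSpace ℝ V]
  [NormedAddCommGroup Vt] [NormedSpace ℝ Vt] {T : ℝ} {p : ℝ≥0∞} [Fact (1 ≤ p)] {ι : V →L[ℝ] Vt}

theorem integrable_state (u : StateSpace T p ι) : Integrable (state u) (timeMeasure T) :=
  (Lp.memLp (state u)).integrable Fact.out

theorem integrable_timeDeriv (u : StateSpace T p ι) : Integrable (timeDeriv u) (timeMeasure T) :=
  (Lp.memLp (timeDeriv u)).integrable Fact.out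

/-- Hölder in time. For `p > 1` the exponent is positive, which gives a modulus of continuity in `Ṽ`
uniform on bounded sets of states. -/
theorem integral_norm_timeDeriv_le (u : StateSpace T p ι) (hp : p ≠ ⊤) {t h : ℝ} (ht : 0 < t) (h0 : 0 ≤ h)
    (hth : t + h < T) :
    ∫ r in Ioc t (t + h), ‖timeDeriv u r‖ ≤ h ^ (1 - 1 / p.toReal) * ‖u‖ := by
  have hsub : Ioc t (t + h) ⊆ Ioo 0 T := fun r hr => ⟨ht.trans hr.1, hr.2.trans_lt hth⟩
  have hle : volume.restrict (Ioc t (t + h)) ≤ timeMeasure T := Measure.restrict_mono hsub le_rfl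
  have hm := (Lp.aestronglyMeasurable (timeDeriv u)).mono_measure hle
  have hP : 1 ≤ p.toReal := by
    rw [← ENNReal.toReal_one]
    exact ENNReal.toReal_mono hp Fact.out
  have hexp : 0 ≤ 1 - 1 / p.toReal := by
    rw [sub_nonneg, div_le_one (by linarith)]
    exact hP
  have h1 := eLpNorm_le_eLpNorm_mul_rpow_measure_univ (μ := volume.restrict (Ioc t (t + h)))
    (p := 1) (q := p) Fact.out hm
  have h2 : eLpNorm (timeDeriv u) p (volume.restrict (Ioc t (t + h))) ≤ ENNReal.ofReal ‖u‖ := by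
    refine (eLpNorm_mono_measure _ hle).trans ?_
    rw [← ENNReal.ofReal_toReal (Lp.memLp (timeDeriv u)).eLpNorm_ne_top, ← Lp.norm_def]
    exact ENNReal.ofReal_le_ofReal (norm_timeDeriv_le u)
  rw [integral_norm_eq_lintegral_enorm hm, ← eLpNorm_one_eq_lintegral_enorm]
  refine ENNReal.toReal_le_of_le_ofReal (by positivity) (h1.trans ?_)
  rw [mul_comm, ENNReal.ofReal_mul (by positivity)]
  gcongr
  rw [Measure.restrict_apply MeasurableSet.univ, univ_inter, Real.volume_Ioc, add_sub_cancel_left,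
    ENNReal.toReal_one, div_one, ENNReal.ofReal_rpow_of_nonneg h0 hexp]

variable [CompleteSpace Vt]

/-- The difference of `ι ∘ u` and the primitive of its weak derivative has weak derivative zero,
hence is constant by du Bois-Reymond. -/
theorem ae_eq_primitive (hT : 0 < T) (u : StateSpace T p ι) :
    ∃ c : Vt, ∀ᵐ t ∂timeMeasure T, ι (state u t) = c + ∫ s in Ioo 0 t, timeDeriv u s := by
  have hw : IntegrableOn (timeDeriv u) (Ioo 0 T) := integrable_timeDeriv u
  have hz : IntegrableOn (fun t => ι (state u t)) (Ioo 0 T) := ι.integrable_comp (integrable_state u)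
  have hW : IntegrableOn (fun t => ∫ s in Ioo 0 t, timeDeriv u s) (Ioo 0 T) := by
    have h1 : IntegrableOn (timeDeriv u) (Icc 0 T) := by
      rwa [integrableOn_Icc_iff_integrableOn_Ioo]
    have h2 := intervalIntegral.continuousOn_primitive h1
    simp_rw [integral_Ioc_eq_integral_Ioo] at h2
    exact (h2.integrableOn_compact isCompact_Icc).mono_set Ioo_subset_Icc_self
  obtain ⟨c, hc⟩ := ae_eq_const_of_integral_deriv_smul hT (hz.sub hW) fun φ hφ => by
    have hd : Continuous (deriv φ) := hφ.smooth.continuous_deriv (by simp)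
    obtain ⟨C, hC⟩ := hφ.hasCompactSupport.deriv.exists_bound_of_continuous hd
    have hi : ∀ {g : ℝ → Vt}, IntegrableOn g (Ioo 0 T) →
        IntegrableOn (fun t => deriv φ t • g t) (Ioo 0 T) := fun hg =>
      hg.bdd_smul C hd.aestronglyMeasurable (Eventually.of_forall hC)
    have h1 : ∫ t in Ioo 0 T, deriv φ t • (ι (state u t) - ∫ s in Ioo 0 t, timeDeriv u s) =
        (∫ t in Ioo 0 T, deriv φ t • ι (state u t)) -
          ∫ t in Ioo 0 T, deriv φ t • ∫ s in Ioo 0 t, timeDeriv u s := by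
      rw [← integral_sub (hi hz) (hi hW)]
      simp_rw [smul_sub]
    refine h1.trans ?_
    rw [integral_deriv_smul_primitive hw hφ, sub_eq_zero]
    exact u.2 φ hφ
  refine ⟨c, ?_⟩
  filter_upwards [hc] with t ht
  rw [← ht]
  simp

theorem ae_norm_sub_le (hT : 0 < T) (u : StateSpace T p ι) :
    ∀ᵐ t ∂timeMeasure T, ∀ᵐ s ∂timeMeasure T, t ≤ s →
      ‖ι (state u t) - ι (state u s)‖ ≤ ∫ r in Ioc t s, ‖timeDeriv u r‖ := by
  have hw : IntegrableOn (timeDeriv u) (Ioo 0 T) := integrable_timeDeriv u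
  obtain ⟨c, hc⟩ := ae_eq_primitive hT u
  filter_upwards [hc, ae_restrict_mem measurableSet_Ioo] with t ht htm
  filter_upwards [hc, ae_restrict_mem measurableSet_Ioo] with s hs hsm hts
  have h1 : ∀ r ∈ Ioo 0 T, IntervalIntegrable (timeDeriv u) volume 0 r := fun r hr => by
    rw [intervalIntegrable_iff_integrableOn_Ioo_of_le hr.1.le]
    exact hw.mono_set (Ioo_subset_Ioo_right hr.2.le)
  have h2 : ∀ r ∈ Ioo 0 T, ∫ x in Ioo 0 r, timeDeriv u x = ∫ x in (0 : ℝ)..r, timeDeriv u x :=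
    fun r hr => by rw [intervalIntegral.integral_of_le hr.1.le, integral_Ioc_eq_integral_Ioo]
  rw [ht, hs, h2 t htm, h2 s hsm, add_sub_add_left_eq_sub, norm_sub_rev,
    intervalIntegral.integral_interval_sub_left (h1 s hsm) (h1 t htm),
    intervalIntegral.integral_of_le hts]
  exact norm_integral_le_integral_norm _

/-- Bounded weak null sequences in the state space converge to zero pointwise almost everywhere after
applying a compact operator which factors through `Ṽ`. -/
theorem ae_tendsto_zero_of_compact [CompleteSpace V] (hT : 0 < T) (hp1 : 1 < p) (hp : p ≠ ⊤)
    {Z : Type*} [NormedAddCommGroup Z] [NormedSpace ℝ Z] {L : V →L[ℝ] Z} (B : Vt →L[ℝ] Z)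
    (hLB : ∀ v, L v = B (ι v)) (hL : IsCompactOperator L) {u : ℕ → StateSpace T p ι} {M : ℝ}
    (hM : ∀ n, ‖u n‖ ≤ M) (hu : WeakTendsto u 0) :
    ∀ᵐ t ∂timeMeasure T, Tendsto (fun n => L (state (u n) t)) atTop (𝓝 0) := by
  have hosc := ae_all_iff.2 fun n => ae_norm_sub_le hT (u n)
  filter_upwards [hosc, ae_restrict_mem measurableSet_Ioo] with t ht htm
  rw [NormedAddGroup.tendsto_nhds_zero]
  intro e he
  have hP : 1 < p.toReal := by
    rw [← ENNReal.toReal_one]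
    exact (ENNReal.toReal_lt_toReal ENNReal.one_ne_top hp).2 hp1
  have hexp : 0 < 1 - 1 / p.toReal := by
    rw [sub_pos, div_lt_one (by linarith)]
    exact hP
  -- The window is so short that the oscillation of every state over it contributes less than `e /
  -- 2`, uniformly in `n`.
  obtain ⟨h, h0, hth, hhe⟩ : ∃ h : ℝ, 0 < h ∧ t + h < T ∧
      ‖B‖ * (h ^ (1 - 1 / p.toReal) * M) < e / 2 := by
    have h1 : Tendsto (fun h : ℝ => ‖B‖ * (h ^ (1 - 1 / p.toReal) * M)) (𝓝[>] 0) (𝓝 0) := by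
      have : ContinuousAt (fun h : ℝ => ‖B‖ * (h ^ (1 - 1 / p.toReal) * M)) 0 :=
        continuousAt_const.mul ((Real.continuousAt_rpow_const _ _ (Or.inr hexp.le)).mul continuousAt_const)
      have h2 := this.tendsto
      rw [Real.zero_rpow hexp.ne', zero_mul, mul_zero] at h2
      exact h2.mono_left nhdsWithin_le_nhds
    have h2 : ∀ᶠ h : ℝ in 𝓝[>] 0, h < T - t :=
      nhdsWithin_le_nhds (Iio_mem_nhds (by linarith [htm.2]))
    obtain ⟨h, h3, h4, h5⟩ := ((h1.eventually_lt_const (half_pos he)).and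
      (h2.and self_mem_nhdsWithin)).exists
    exact ⟨h, h5, by linarith, h3⟩
  have hsub : Ioc t (t + h) ⊆ Ioo 0 T := fun r hr => ⟨htm.1.trans hr.1, hr.2.trans_lt hth⟩
  have hchi : MemLp ((Ioc t (t + h)).indicator fun _ => (1 : ℝ)) p.conjExponent (timeMeasure T) :=
    memLp_indicator_const _ measurableSet_Ioc _ (Or.inr (measure_ne_top _ _))
  -- Averaging over the window is bounded into `V`, although point values have no uniform bound
  -- there. The averages thus tend weakly to zero in `V`, and `L` makes this convergence strong.
  let I := weightedIntegral p V hchi ∘L stateL (ι := ι)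
  have hI : ∀ n, I (u n) = ∫ s in Ioc t (t + h), state (u n) s := by
    intro n
    change weightedIntegral p V hchi (state (u n)) = _
    rw [weightedIntegral_apply]
    have h1 : ∀ s, (Ioc t (t + h)).indicator (fun _ => (1 : ℝ)) s • state (u n) s =
        (Ioc t (t + h)).indicator (state (u n)) s := fun s => by
      by_cases hs : s ∈ Ioc t (t + h) <;> simp [hs]
    simp_rw [h1]
    rw [integral_indicator measurableSet_Ioc, Measure.restrict_restrict measurableSet_Ioc,
      inter_eq_left.2 hsub]
  have hLI : Tendsto (fun n => L (I (u n))) atTop (𝓝 0) := by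
    refine tendsto_zero_of_compact hL (M := ‖I‖ * M) (fun n => I.le_opNorm_of_le (hM n)) ?_
    have := hu.map I
    rwa [map_zero] at this
  have hev := (NormedAddGroup.tendsto_nhds_zero.1 hLI) (h * (e / 2)) (by positivity)
  filter_upwards [hev] with n hn
  have hi : IntegrableOn (state (u n)) (Ioc t (t + h)) :=
    IntegrableOn.mono_set (integrable_state (u n)) hsub
  have h1 : h • ι (state (u n) t) - ι (I (u n)) =
      ∫ s in Ioc t (t + h), (ι (state (u n) t) - ι (state (u n) s)) := by
    rw [integral_sub (integrable_const _) (ι.integrable_comp hi), hI, ι.integral_comp_comm hi,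
      integral_const]
    simp [h0.le]
  have h2 : ‖h • ι (state (u n) t) - ι (I (u n))‖ ≤ (h ^ (1 - 1 / p.toReal) * M) * h := by
    rw [h1]
    have h3 := norm_setIntegral_le_of_norm_le_const_ae (μ := volume) (s := Ioc t (t + h))
      (f := fun s => ι (state (u n) t) - ι (state (u n) s)) (C := h ^ (1 - 1 / p.toReal) * M)
      (by simp) ?_
    · simpa [Measure.real, h0.le] using h3
    · have h4 := ae_restrict_of_ae_restrict_of_subset hsub (ht n)
      filter_upwards [h4, ae_restrict_mem measurableSet_Ioc] with s hs hsm
      refine (hs hsm.1.le).trans ?_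
      have h5 : ∫ r in Ioc t s, ‖timeDeriv (u n) r‖ ≤ ∫ r in Ioc t (t + h), ‖timeDeriv (u n) r‖ := by
        refine setIntegral_mono_set ?_ (Eventually.of_forall fun r => norm_nonneg _)
          (Ioc_subset_Ioc_right hsm.2).eventuallyLE
        exact (IntegrableOn.mono_set (integrable_timeDeriv (u n)) hsub).norm
      refine h5.trans ((integral_norm_timeDeriv_le (u n) hp htm.1 h0.le hth).trans ?_)
      gcongr
      exact hM n
  -- The average is seen by the compact operator `L`; the deviation from it is small only in `Ṽ` and
  -- is therefore estimated through `B`.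
  have h3 : h • L (state (u n) t) = L (I (u n)) + B (h • ι (state (u n) t) - ι (I (u n))) := by
    rw [map_sub, map_smul, hLB, hLB]
    abel
  have h4 : h * ‖L (state (u n) t)‖ < h * e := by
    calc h * ‖L (state (u n) t)‖ = ‖h • L (state (u n) t)‖ := by
          rw [norm_smul, Real.norm_of_nonneg h0.le]
      _ ≤ ‖L (I (u n))‖ + ‖B‖ * ((h ^ (1 - 1 / p.toReal) * M) * h) := by
          rw [h3]
          exact (norm_add_le _ _).trans (add_le_add le_rfl (B.le_opNorm_of_le h2))
      _ < h * (e / 2) + h * (e / 2) := by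
          refine add_lt_add hn ?_
          calc _ = h * (‖B‖ * (h ^ (1 - 1 / p.toReal) * M)) := by ring
            _ < h * (e / 2) := by gcongr
      _ = h * e := by ring
  exact lt_of_mul_lt_mul_left h4 h0.le

end StateSpace

/-! ### Ehrling's inequality and the Aubin-Lions lemma. -/

/-- A Sobolev function is determined by its values: so are its weak derivatives. -/
theorem SobolevSpace.ext_of_ae_eq {d κ : ℕ} {p : ℝ≥0∞} [Fact (1 ≤ p)] {Ω : Set (EuclideanSpace ℝ (Fin d))}
    (hΩ : IsOpen Ω) [IsFiniteMeasure (volume.restrict Ω)] {v w : SobolevSpace κ p Ω}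
    (h : D (MultiIdx.zero d κ) v =ᵐ[volume.restrict Ω] D (MultiIdx.zero d κ) w) : v = w := by
  rw [← sub_eq_zero]
  have h0 : (v - w).1 (MultiIdx.zero d κ) =ᵐ[volume.restrict Ω] 0 := by
    filter_upwards [h, Lp.coeFn_sub (v.1 (MultiIdx.zero d κ)) (w.1 (MultiIdx.zero d κ))] with x h1 h2
    change (v.1 (MultiIdx.zero d κ) - w.1 (MultiIdx.zero d κ) : Lp ℝ p (volume.restrict Ω)) x = 0
    rw [h2]
    exact sub_eq_zero.2 h1
  generalize v - w = f at h0
  refine Subtype.ext (funext fun β => ?_)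
  have hi : IntegrableOn (f.1 β) Ω := (Lp.memLp (f.1 β)).integrable Fact.out
  have h1 := hΩ.ae_eq_zero_of_integral_contDiff_smul_eq_zero (μ := volume) hi.locallyIntegrableOn
    fun φ hφ1 hφ2 hφ3 => by
      have h2 := f.2 β φ ⟨hφ1, hφ2, hφ3⟩
      have h3 : ∫ x in Ω, multiDeriv β φ x • f.1 (MultiIdx.zero d κ) x = 0 := by
        rw [← integral_zero (α := EuclideanSpace ℝ (Fin d)) (G := ℝ) (μ := volume.restrict Ω)]
        refine integral_congr_ae ?_
        filter_upwards [h0] with x hx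
        simp [hx]
      rw [h3] at h2
      have h4 := (mul_eq_zero.1 h2.symm).resolve_left (pow_ne_zero _ (by norm_num))
      rw [← h4, setIntegral_eq_integral_of_forall_compl_eq_zero]
      intro x hx
      rw [image_eq_zero_of_notMem_tsupport fun h => hx (hφ3 h), zero_smul]
  refine (Lp.eq_zero_iff_ae_eq_zero).2 ?_
  exact (ae_restrict_iff' hΩ.measurableSet).2 h1

/-- A compactness form of Ehrling's lemma. -/
theorem exists_forall_norm_lt {V Z Z' : Type*} [NormedAddCommGroup V] [NormedSpace ℝ V]
    [NormedAddCommGroup Z] [NormedSpace ℝ Z] [NormedAddCommGroup Z'] [NormedSpace ℝ Z']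
    {L : V →L[ℝ] Z} (hL : IsCompactOperator L) {j : Z →L[ℝ] Z'} (hj : Function.Injective j)
    (M : ℝ) {e : ℝ} (he : 0 < e) :
    ∃ δ : ℝ, 0 < δ ∧ ∀ v, ‖v‖ ≤ M → ‖j (L v)‖ < δ → ‖L v‖ < e := by
  by_contra! h
  -- A failing `δ = 1 / (n + 1)` for each `n` gives a sequence whose images under `L` accumulate at
  -- a point `b` with `j b = 0` and `‖b‖ ≥ e`.
  choose v hvM hvj hvL using fun n : ℕ => h (1 / ((n : ℝ) + 1)) (by positivity)
  obtain ⟨K, hK, hsub⟩ := hL.image_closedBall_subset_compact (f := (L : V →ₗ[ℝ] Z)) M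
  obtain ⟨b, -, φ, hφ, hb⟩ := hK.tendsto_subseq (x := fun n => L (v n))
    fun n => hsub ⟨v n, by simpa using hvM n, rfl⟩
  have h1 : e ≤ ‖b‖ := ge_of_tendsto' hb.norm fun n => hvL (φ n)
  have h2 : Tendsto (fun n => j (L (v n))) atTop (𝓝 0) :=
    squeeze_zero_norm (fun n => (hvj n).le) tendsto_one_div_add_atTop_nhds_zero_nat
  have h3 : j b = 0 :=
    tendsto_nhds_unique ((j.continuous.tendsto b).comp hb) (h2.comp hφ.tendsto_atTop)
  rw [map_eq_zero_iff j hj] at h3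
  rw [h3, norm_zero] at h1
  linarith

namespace StateSpace

/-- The lemma of Aubin and Lions, for a compact operator `L : V → Z` and an embedding `Z → Ṽ`. -/
theorem tendstoInMeasure_of_factor {V Vt Z : Type*} [NormedAddCommGroup V] [NormedSpace ℝ V]
    [CompleteSpace V] [NormedAddCommGroup Vt] [NormedSpace ℝ Vt] [CompleteSpace Vt]
    [NormedAddCommGroup Z] [NormedSpace ℝ Z] {T : ℝ} {p : ℝ≥0∞} [Fact (1 ≤ p)] {ι : V →L[ℝ] Vt}
    (hT : 0 < T) (hp1 : 1 < p) (hp : p ≠ ⊤) {L : V →L[ℝ] Z} (hL : IsCompactOperator L)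
    {j : Z →L[ℝ] Vt} (hj : Function.Injective j) (hjc : ∀ v, ι v = j (L v))
    {v : ℕ → StateSpace T p ι} {M : ℝ} (hM : ∀ n, ‖v n‖ ≤ M) (hv : WeakTendsto v 0) :
    TendstoInMeasure (timeMeasure T) (fun n t => L (state (v n) t)) atTop fun _ => 0 := by
  have hcomp : IsCompactOperator ι := by
    have h2 : (ι : V → Vt) = j ∘ L := funext hjc
    rw [h2]
    exact hL.clm_comp j
  have hVt := tendstoInMeasure_of_tendsto_ae (g := fun _ => (0 : Vt))
    (fun n => ι.continuous.comp_aestronglyMeasurable (Lp.aestronglyMeasurable (state (v n))))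
    (ae_tendsto_zero_of_compact (L := ι) hT hp1 hp (ContinuousLinearMap.id ℝ Vt) (fun _ => rfl)
      hcomp hM hv)
  rw [tendstoInMeasure_iff_norm] at hVt ⊢
  intro e he
  rw [ENNReal.tendsto_nhds_zero]
  intro η hη
  have hp0 : p ≠ 0 := (zero_lt_one.trans hp1).ne'
  have hP : 0 < p.toReal := ENNReal.toReal_pos hp0 hp
  -- By Chebyshev the states exceed norm `k` in `V` only on a set of measure at most `(M / k)^p ≤ η
  -- / 2`. Off that set Ehrling's inequality applies, which is why convergence is obtained in
  -- measure.
  obtain ⟨k, hk0, hk⟩ : ∃ k : ℝ, 0 < k ∧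
      (ENNReal.ofReal k)⁻¹ ^ p.toReal * ENNReal.ofReal M ^ p.toReal ≤ η / 2 := by
    have h1 : Tendsto (fun k : ℝ => (ENNReal.ofReal k)⁻¹ ^ p.toReal * ENNReal.ofReal M ^ p.toReal)
        atTop (𝓝 0) := by
      have h2 : Tendsto (fun k : ℝ => (ENNReal.ofReal k)⁻¹) atTop (𝓝 0) := by
        rw [← ENNReal.inv_top]
        exact ENNReal.tendsto_ofReal_atTop.inv
      have h3 := (ENNReal.continuous_rpow_const (y := p.toReal)).tendsto 0 |>.comp h2
      rw [ENNReal.zero_rpow_of_pos hP] at h3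
      have h4 := ENNReal.Tendsto.mul_const (b := ENNReal.ofReal M ^ p.toReal) h3
        (Or.inr (ENNReal.rpow_ne_top_of_nonneg hP.le ENNReal.ofReal_ne_top))
      rwa [zero_mul] at h4
    have h5 := (ENNReal.tendsto_nhds_zero.1 h1) (η / 2) (ENNReal.half_pos hη.ne')
    obtain ⟨k, h6, h7⟩ := (h5.and (eventually_gt_atTop 0)).exists
    exact ⟨k, h7, h6⟩
  obtain ⟨δ, hδ, hδe⟩ := exists_forall_norm_lt hL hj k he
  filter_upwards [(ENNReal.tendsto_nhds_zero.1 (hVt δ hδ)) (η / 2) (ENNReal.half_pos hη.ne')] with n hn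
  have hsub : {t | e ≤ ‖L (state (v n) t) - 0‖} ⊆
      {t | ENNReal.ofReal k ≤ ‖state (v n) t‖ₑ} ∪
        {t | δ ≤ ‖ι (state (v n) t) - 0‖} := by
    intro t ht
    by_contra hcon
    simp only [mem_union, mem_ofPred_eq, not_or, not_le, sub_zero] at hcon ht
    refine absurd (hδe _ ?_ ?_) (not_lt.2 ht)
    · have h1 := hcon.1.le
      rw [← ofReal_norm] at h1
      exact (ENNReal.ofReal_le_ofReal_iff hk0.le).1 h1
    · rw [← hjc]
      exact hcon.2
  refine (measure_mono hsub).trans ((measure_union_le _ _).trans ?_)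
  rw [← ENNReal.add_halves η]
  refine add_le_add ?_ hn
  refine (meas_ge_le_mul_pow_eLpNorm_enorm _ hp0 hp (Lp.aestronglyMeasurable _)
    (by simpa using hk0) (by simp)).trans (le_trans ?_ hk)
  gcongr
  rw [← ENNReal.ofReal_toReal (Lp.memLp (state (v n))).eLpNorm_ne_top, ← Lp.norm_def]
  exact ENNReal.ofReal_le_ofReal ((norm_state_le _).trans (hM n))

end StateSpace

/-! ### Strong convergence in the Sobolev space. -/

namespace SpaceSetup

theorem exists_sameFunction {d κ : ℕ} {Ω : Set (EuclideanSpace ℝ (Fin d))} {ph qh : ℝ≥0∞}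
    [Fact (1 ≤ ph)] [IsFiniteMeasure (volume.restrict Ω)] (hqph : qh ≤ ph)
    (s : SobolevSpace κ ph Ω) :
    ∃ g : Lp ℝ qh (volume.restrict Ω), SobolevSpace.SameFunction s g := by
  have h : MemLp (SobolevSpace.D (MultiIdx.zero d κ) s) qh (volume.restrict Ω) :=
    (Lp.memLp _).mono_exponent hqph
  exact ⟨h.toLp _, h.coeFn_toLp.symm⟩

variable {d κ : ℕ} {Ω : Set (EuclideanSpace ℝ (Fin d))}
  {ph qh : ℝ≥0∞} [Fact (1 ≤ ph)] [Fact (1 ≤ qh)]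
  {V Vt W Y : Type*} {Vk : Fin κ → Type*}
  [NormedAddCommGroup V] [NormedSpace ℝ V] [NormedAddCommGroup Vt] [NormedSpace ℝ Vt]
  [NormedAddCommGroup W] [NormedSpace ℝ W] [NormedAddCommGroup Y] [NormedSpace ℝ Y]
  [∀ k, NormedAddCommGroup (Vk k)] [∀ k, NormedSpace ℝ (Vk k)]
  (S : SpaceSetup κ Ω ph qh V Vt W Y Vk)

/-- The embeddings between `V`, `Ṽ` and the Sobolev space commute. -/
theorem sob_vt_comm (hΩ : IsOpen Ω) [IsFiniteMeasure (volume.restrict Ω)] (hqph : qh ≤ ph) :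
    (∃ j : SobolevSpace κ ph Ω →L[ℝ] Vt, Function.Injective j ∧ ∀ v, S.toVt v = j (S.toSob v)) ∨
    (∃ j : Vt →L[ℝ] SobolevSpace κ ph Ω, ∀ v, S.toSob v = j (S.toVt v)) := by
  rcases S.sob_vt with ⟨j, hj, hjc⟩ | ⟨j, hj, hjc⟩
  · refine Or.inl ⟨j, hj, fun v => S.vtToW_injective ?_⟩
    obtain ⟨g, hg⟩ := exists_sameFunction hqph (S.toSob v)
    rw [hjc _ g hg, S.v_compat v g hg]
  · refine Or.inr ⟨j, fun v => SobolevSpace.ext_of_ae_eq hΩ ?_⟩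
    obtain ⟨g, hg⟩ := exists_sameFunction hqph (S.toSob v)
    obtain ⟨g', hg'⟩ := exists_sameFunction hqph (j (S.toVt v))
    -- The two functions are compared inside `W`, the only space in which both compatibility
    -- conditions are stated.
    have h1 : g = g' := S.lqToW_injective (by rw [← S.v_compat v g hg, hjc _ g' hg'])
    subst h1
    filter_upwards [hg, hg'] with x h2 h3
    rw [h2, h3]

variable {T : ℝ} {p : ℝ≥0∞} [Fact (1 ≤ p)]

/-- If the Sobolev space embeds in `Ṽ`, this is Aubin-Lions. In the opposite case the compact
embedding itself factors through `Ṽ`, and convergence holds almost everywhere. -/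
theorem tendstoInMeasure_toSob [CompleteSpace V] [CompleteSpace Vt] (hΩ : IsOpen Ω)
    [IsFiniteMeasure (volume.restrict Ω)] (hqph : qh ≤ ph) (hT : 0 < T) (hp1 : 1 < p) (hp : p ≠ ⊤)
    {v : ℕ → S.State T p} {M : ℝ} (hM : ∀ n, ‖v n‖ ≤ M) (hv : WeakTendsto v 0) :
    TendstoInMeasure (timeMeasure T) (fun n t => S.toSob (StateSpace.state (v n) t)) atTop
      fun _ => 0 := by
  rcases S.sob_vt_comm hΩ hqph with ⟨j, hj, hjc⟩ | ⟨j, hjc⟩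
  · exact StateSpace.tendstoInMeasure_of_factor hT hp1 hp S.toSob_compact hj hjc hM hv
  · exact tendstoInMeasure_of_tendsto_ae
      (fun n => S.toSob.continuous.comp_aestronglyMeasurable
        (Lp.aestronglyMeasurable (StateSpace.state (v n))))
      (StateSpace.ae_tendsto_zero_of_compact (L := S.toSob) hT hp1 hp j hjc S.toSob_compact hM hv)

/-- Weak convergence in the state space implies strong convergence in the Sobolev space at almost every
time, along a subsequence. -/
theorem exists_subseq_ae_tendsto_toSob [CompleteSpace V] [CompleteSpace Vt] (hΩ : IsOpen Ω)
    [IsFiniteMeasure (volume.restrict Ω)] (hqph : qh ≤ ph) (hT : 0 < T) (hp1 : 1 < p) (hp : p ≠ ⊤)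
    {u : ℕ → S.State T p} {a : S.State T p} {M : ℝ} (hM : ∀ n, ‖u n‖ ≤ M) (hu : WeakTendsto u a) :
    ∃ φ : ℕ → ℕ, StrictMono φ ∧ ∀ᵐ t ∂timeMeasure T,
      Tendsto (fun n => S.toSob (StateSpace.state (u (φ n)) t)) atTop
        (𝓝 (S.toSob (StateSpace.state a t))) := by
  obtain ⟨φ, hφ, h⟩ := (S.tendstoInMeasure_toSob hΩ hqph hT hp1 hp (v := fun n => u n - a)
    (M := M + ‖a‖) (fun n => (norm_sub_le _ _).trans (add_le_add (hM n) le_rfl))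
    hu.sub_const).exists_seq_tendsto_ae
  refine ⟨φ, hφ, ?_⟩
  have hsub : ∀ᵐ t ∂timeMeasure T, ∀ n, StateSpace.state (u n - a) t =
      StateSpace.state (u n) t - StateSpace.state a t :=
    ae_all_iff.2 fun n => Lp.coeFn_sub (StateSpace.state (u n)) (StateSpace.state a)
  filter_upwards [h, hsub] with t h1 h2
  simp_rw [h2, map_sub] at h1
  have h3 := h1.add_const (S.toSob (StateSpace.state a t))
  simpa using h3

end SpaceSetup

/-! ### Continuity of networks and compactness of parameters. -/

section Network

theorem continuous_polyEval {n d : ℕ} :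
    Continuous fun z : Coeff n d × (Fin n → ℝ) => polyEval z.1 z.2 := by
  unfold polyEval
  fun_prop

theorem isClosed_normalizedDenominators (ε : ℝ) (n d : ℕ) : IsClosed (normalizedDenominators ε n d) := by
  have h : normalizedDenominators ε n d =
      (⋂ x : Fin n → ℝ, {b | ε ≤ polyEval b x}) ∩ {b | ‖b‖ = 1} := by
    ext b
    simp [normalizedDenominators]
  rw [h]
  refine (isClosed_iInter fun x => isClosed_le continuous_const ?_).inter
    (isClosed_eq continuous_norm continuous_const)
  exact continuous_polyEval.comp (.prodMk_left x)

namespace Architecture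

variable (A : Architecture) {ε : ℝ}

theorem isClosed_paramSet (ε : ℝ) : IsClosed (A.paramSet ε) := by
  have h : A.paramSet ε = (⋂ (i : Fin A.L) (k : Fin (A.rwidth i)),
      {θ | (θ.1 i k).2 ∈ normalizedDenominators ε (A.width i) (A.degree i)}) ∩
      {θ | θ.2.2 ∈ normalizedDenominators ε (A.width A.L + A.width 0) (A.degree A.L)} := by
    ext θ
    simp [paramSet]
  rw [h]
  refine (isClosed_iInter fun i => isClosed_iInter fun k => ?_).inter ?_
  · exact (isClosed_normalizedDenominators _ _ _).preimage (by fun_prop)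
  · exact (isClosed_normalizedDenominators _ _ _).preimage (by fun_prop)

/-- Denominators stay above `ε > 0` on the whole parameter set, so no quotient degenerates in the
limit. -/
theorem continuous_hidden (hε : 0 < ε) (i : ℕ) (hi : i ≤ A.L) :
    Continuous fun z : A.paramSet ε × (Fin (A.width 0) → ℝ) => A.hidden z.1.1 z.2 i hi := by
  induction i with
  | zero => exact continuous_snd
  | succ i ih =>
    have ih := ih (Nat.le_of_succ_le hi)
    refine (A.act_base i hi).1.comp (continuous_pi fun k => Continuous.div ?_ ?_ fun z => ?_)
    · exact continuous_polyEval.comp (Continuous.prodMk (by fun_prop) ih)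
    · exact continuous_polyEval.comp (Continuous.prodMk (by fun_prop) ih)
    · exact (hε.trans_le ((z.1.2.1 ⟨i, hi⟩ k).1 _)).ne'

/-- The network depends continuously on its parameters and its input. -/
theorem continuous_eval (hε : 0 < ε) :
    Continuous fun z : A.paramSet ε × (Fin (A.width 0) → ℝ) => A.eval z.1.1 z.2 := by
  have h : Continuous fun z : A.paramSet ε × (Fin (A.width 0) → ℝ) =>
      Fin.append (A.hidden z.1.1 z.2 A.L le_rfl) z.2 := by
    refine continuous_pi fun i => ?_
    refine Fin.addCases (fun j => ?_) (fun j => ?_) i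
    · simp only [Fin.append_left]
      exact (continuous_apply j).comp (A.continuous_hidden hε A.L le_rfl)
    · simp only [Fin.append_right]
      exact (continuous_apply j).comp continuous_snd
  refine Continuous.div ?_ ?_ fun z => ?_
  · exact continuous_polyEval.comp (Continuous.prodMk (by fun_prop) h)
  · exact continuous_polyEval.comp (Continuous.prodMk (by fun_prop) h)
  · exact (hε.trans_le (z.1.2.2.1 _)).ne'

/-- Convergence of parameters implies locally uniform convergence of networks. -/
theorem tendsto_eLpNorm_top_restrict (hε : 0 < ε) {θ : ℕ → A.paramSet ε} {θt : A.paramSet ε}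
    (hθ : Tendsto θ atTop (𝓝 θt)) {B : Set (Fin (A.width 0) → ℝ)} (hB : IsCompact B) :
    Tendsto (fun l => eLpNorm (fun x => A.eval (θ l).1 x - A.eval θt.1 x) ⊤ (volume.restrict B))
      atTop (𝓝 0) := by
  -- Currying turns joint continuity into continuity for the compact-open topology, that is, uniform
  -- convergence on compact sets.
  let F : C(A.paramSet ε, C(Fin (A.width 0) → ℝ, ℝ)) := ContinuousMap.curry ⟨_, A.continuous_eval hε⟩
  have h1 := (F.continuous.tendsto θt).comp hθ
  have h2 := ContinuousMap.tendsto_iff_forall_isCompact_tendstoUniformlyOn.1 h1 B hB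
  rw [Metric.tendstoUniformlyOn_iff] at h2
  rw [ENNReal.tendsto_nhds_zero]
  intro η hη
  obtain ⟨e, he0, heη⟩ : ∃ e : ℝ, 0 < e ∧ ENNReal.ofReal e ≤ η := by
    by_cases h : η = ⊤
    · exact ⟨1, one_pos, h ▸ le_top⟩
    · exact ⟨η.toReal, ENNReal.toReal_pos hη.ne' h, ENNReal.ofReal_toReal_le⟩
  filter_upwards [h2 e he0] with l hl
  refine le_trans ?_ heη
  rw [eLpNorm_exponent_top]
  refine eLpNormEssSup_le_of_ae_bound ?_
  filter_upwards [ae_restrict_mem hB.measurableSet] with x hx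
  have := (hl x hx).le
  rwa [dist_comm, dist_eq_norm] at this

theorem exists_tendsto_subseq_of_bounded {θ : ℕ → A.paramSet ε} {s : Set (A.paramSet ε)}
    (hs : Bornology.IsBounded s) (hθ : ∀ m, θ m ∈ s) :
    ∃ (ns : ℕ → ℕ) (θt : A.paramSet ε), StrictMono ns ∧ Tendsto (fun l => θ (ns l)) atTop (𝓝 θt) := by
  have : ProperSpace (A.paramSet ε) := .of_isClosed (A.isClosed_paramSet ε)
  obtain ⟨θt, -, ns, hns, h⟩ := tendsto_subseq_of_bounded hs hθ
  exact ⟨ns, θt, hns, h⟩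

end Architecture

theorem IsRegularizer.isBounded_sublevel {X : Type*} [NormedAddCommGroup X] {Θ : Set X} {R₀ : Θ → ℝ≥0∞}
    (h : IsRegularizer R₀) {C : ℝ≥0∞} (hC : C ≠ ⊤) : Bornology.IsBounded {θ | R₀ θ ≤ C} := by
  have h1 := h.coercive.eventually_const_lt hC.lt_top
  rw [← Bornology.isCobounded_compl_iff]
  filter_upwards [h1] with θ hθ
  exact not_le.2 hθ

end Network

/-! ### Truncated superposition operators on `L^p`. -/

section Superposition

section

variable {ι : Type*}

/-- Truncation of a vector to the cube `[-M, M]^ι`. -/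
def clamp (M : ℝ) (ξ : ι → ℝ) : ι → ℝ := fun i => max (-M) (min M (ξ i))

theorem continuous_clamp (M : ℝ) : Continuous (clamp (ι := ι) M) := by
  unfold clamp
  fun_prop

theorem clamp_eq_self {M : ℝ} {ξ : ι → ℝ} (h : ∀ i, |ξ i| ≤ M) : clamp M ξ = ξ := by
  funext i
  have := abs_le.1 (h i)
  rw [clamp, min_eq_right this.2, max_eq_right this.1]

theorem clamp_mem {M : ℝ} (hM : 0 ≤ M) (ξ : ι → ℝ) : clamp M ξ ∈ Set.pi univ fun _ : ι => Icc (-M) M :=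
  fun _ _ => ⟨le_max_left _ _, max_le (by linarith) (min_le_left _ _)⟩

end

variable {α F : Type*} [MeasurableSpace α] {μ : Measure α} [NormedAddCommGroup F]

/-- Bounded convergence in `L^q`. -/
theorem tendsto_eLpNorm_sub_of_bounded [IsFiniteMeasure μ] {q : ℝ≥0∞} (hq0 : q ≠ 0) (hq : q ≠ ⊤) {f : ℕ → α → F} {g : α → F}
    (hf : ∀ n, AEStronglyMeasurable (f n) μ) (hg : AEStronglyMeasurable g μ) {C : ℝ}
    (hfC : ∀ n, ∀ᵐ x ∂μ, ‖f n x‖ ≤ C) (h : ∀ᵐ x ∂μ, Tendsto (fun n => f n x) atTop (𝓝 (g x))) :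
    Tendsto (fun n => eLpNorm (fun x => f n x - g x) q μ) atTop (𝓝 0) := by
  have hQ : 0 < q.toReal := ENNReal.toReal_pos hq0 hq
  have hgC : ∀ᵐ x ∂μ, ‖g x‖ ≤ C := by
    filter_upwards [ae_all_iff.2 hfC, h] with x h1 h2
    exact le_of_tendsto' h2.norm h1
  have h1 : Tendsto (fun n => ∫⁻ x, ‖f n x - g x‖ₑ ^ q.toReal ∂μ) atTop (𝓝 (∫⁻ _, 0 ∂μ)) := by
    refine tendsto_lintegral_of_dominated_convergence' (fun _ => ENNReal.ofReal (C + C) ^ q.toReal)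
      (fun n => (((hf n).sub hg).enorm).pow_const _) (fun n => ?_) ?_ ?_
    · filter_upwards [hfC n, hgC] with x h1 h2
      gcongr
      rw [← ofReal_norm]
      exact ENNReal.ofReal_le_ofReal ((norm_sub_le _ _).trans (add_le_add h1 h2))
    · rw [lintegral_const]
      exact ENNReal.mul_ne_top (ENNReal.rpow_ne_top_of_nonneg hQ.le ENNReal.ofReal_ne_top)
        (measure_ne_top _ _)
    · filter_upwards [h] with x hx
      have h2 : Tendsto (fun n => ‖f n x - g x‖ₑ) atTop (𝓝 0) := by
        have := (hx.sub_const (g x)).enorm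
        simpa using this
      have h3 := ((ENNReal.continuous_rpow_const (y := q.toReal)).tendsto 0).comp h2
      rwa [ENNReal.zero_rpow_of_pos hQ] at h3
  rw [lintegral_zero] at h1
  simp_rw [eLpNorm_eq_lintegral_rpow_enorm_toReal hq0 hq]
  have h2 := ((ENNReal.continuous_rpow_const (y := 1 / q.toReal)).tendsto 0).comp h1
  rwa [ENNReal.zero_rpow_of_pos (by positivity)] at h2

variable {ι P : Type*} {p q : ℝ≥0∞}

theorem exists_subseq_ae_tendsto_of_tendsto_pi [Fintype ι] [Fact (1 ≤ p)] {f : ℕ → ι → Lp ℝ p μ} {g : ι → Lp ℝ p μ}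
    (h : Tendsto f atTop (𝓝 g)) : ∃ ns : ℕ → ℕ, StrictMono ns ∧
      ∀ᵐ x ∂μ, ∀ i, Tendsto (fun n => f (ns n) i x) atTop (𝓝 (g i x)) := by
  have hp0 : p ≠ 0 := (zero_lt_one.trans_le Fact.out).ne'
  have hm : ∀ n i, AEStronglyMeasurable (fun x => |f n i x - g i x|) μ := fun n i =>
    ((Lp.aestronglyMeasurable (f n i)).sub (Lp.aestronglyMeasurable (g i))).norm
  -- Summing the absolute differences yields one subsequence that serves all components at once.
  have h1 : Tendsto (fun n => eLpNorm ((∑ i, fun x => |f n i x - g i x|) - fun _ => (0 : ℝ)) p μ)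
      atTop (𝓝 0) := by
    have h2 : Tendsto (fun n => ∑ i, eLpNorm (fun x => |f n i x - g i x|) p μ) atTop (𝓝 0) := by
      rw [← Finset.sum_const_zero (ι := ι) (s := Finset.univ)]
      refine tendsto_finsetSum _ fun i _ => ?_
      have h3 := (Lp.tendsto_Lp_iff_tendsto_eLpNorm' _ _).1 (tendsto_pi_nhds.1 h i)
      refine h3.congr fun n => ?_
      exact (eLpNorm_norm (f := fun x => f n i x - g i x)).symm
    refine tendsto_of_tendsto_of_tendsto_of_le_of_le tendsto_const_nhds h2 (fun _ => zero_le) fun n => ?_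
    simp only [Pi.sub_def, sub_zero]
    exact eLpNorm_sum_le (fun i _ => hm n i) Fact.out
  obtain ⟨ns, hns, h4⟩ := (tendstoInMeasure_of_tendsto_eLpNorm hp0
    (fun n => Finset.aestronglyMeasurable_sum _ fun i _ => hm n i) aestronglyMeasurable_const h1).exists_seq_tendsto_ae
  refine ⟨ns, hns, ?_⟩
  filter_upwards [h4] with x hx i
  rw [tendsto_iff_norm_sub_tendsto_zero]
  refine squeeze_zero (fun _ => norm_nonneg _) (fun n => ?_) hx
  rw [Finset.sum_apply]
  exact Finset.single_le_sum (f := fun i => |f (ns n) i x - g i x|) (fun i _ => abs_nonneg _)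
    (Finset.mem_univ i)

variable [TopologicalSpace P]

/-- On compact sets of parameters, truncated superposition operators are uniformly bounded. -/
theorem exists_bound_clamp {Φ : P → (ι → ℝ) → ℝ} (hΦ : Continuous fun z : P × (ι → ℝ) => Φ z.1 z.2)
    {M : ℝ} (hM : 0 ≤ M) {s : Set P} (hs : IsCompact s) :
    ∃ C : ℝ, ∀ p ∈ s, ∀ ξ, ‖Φ p (clamp M ξ)‖ ≤ C := by
  have hK : IsCompact (s ×ˢ Set.pi univ fun _ : ι => Icc (-M) M) :=
    hs.prod (isCompact_univ_pi fun _ => isCompact_Icc)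
  obtain ⟨C, hC⟩ := hK.exists_bound_of_continuousOn hΦ.continuousOn
  exact ⟨C, fun p hp ξ => hC (p, clamp M ξ) ⟨hp, clamp_mem hM ξ⟩⟩

variable [Fintype ι]

theorem aestronglyMeasurable_superposition {Φ : P → (ι → ℝ) → ℝ}
    (hΦ : Continuous fun z : P × (ι → ℝ) => Φ z.1 z.2) (z : P) (f : ι → Lp ℝ p μ) :
    AEStronglyMeasurable (fun x => Φ z fun i => f i x) μ := by
  have h1 : Continuous (Φ z) := hΦ.comp (.prodMk_right z)
  refine h1.comp_aestronglyMeasurable ?_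
  exact (aemeasurable_pi_lambda _ fun i => (Lp.aestronglyMeasurable (f i)).aemeasurable).aestronglyMeasurable

variable [IsFiniteMeasure μ]

theorem memLp_superposition_clamp {Φ : P → (ι → ℝ) → ℝ}
    (hΦ : Continuous fun z : P × (ι → ℝ) => Φ z.1 z.2) {M : ℝ} (hM : 0 ≤ M) (z : P) (f : ι → Lp ℝ p μ) :
    MemLp (fun x => Φ z (clamp M fun i => f i x)) q μ := by
  obtain ⟨C, hC⟩ := exists_bound_clamp hΦ hM (isCompact_singleton (x := z))
  refine MemLp.of_bound (aestronglyMeasurable_superposition (Φ := fun z ξ => Φ z (clamp M ξ))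
    (hΦ.comp (continuous_fst.prodMk ((continuous_clamp M).comp continuous_snd))) z f) C
    (Eventually.of_forall fun x => hC z rfl _)

/-- Truncated superposition operators are continuous in the parameter and the function. -/
theorem continuous_superposition_clamp [Fact (1 ≤ p)] [Fact (1 ≤ q)] [FirstCountableTopology P] {Φ : P → (ι → ℝ) → ℝ}
    (hΦ : Continuous fun z : P × (ι → ℝ) => Φ z.1 z.2) {M : ℝ} (hM : 0 ≤ M) (hq : q ≠ ⊤) :
    Continuous fun z : P × (ι → Lp ℝ p μ) =>
      (memLp_superposition_clamp (q := q) hΦ hM z.1 z.2).toLp _ := by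
  have hq0 : q ≠ 0 := (zero_lt_one.trans_le Fact.out).ne'
  rw [continuous_iff_seqContinuous]
  intro z a hz
  refine tendsto_of_subseq_tendsto fun ns hns => ?_
  have hz1 : Tendsto (fun n => (z (ns n)).1) atTop (𝓝 a.1) := ((continuous_fst.tendsto a).comp hz).comp hns
  have hz2 : Tendsto (fun n => (z (ns n)).2) atTop (𝓝 a.2) := ((continuous_snd.tendsto a).comp hz).comp hns
  -- Strong convergence gives pointwise convergence only along a subsequence, hence the subsequence
  -- criterion above.
  obtain ⟨ms, hms, hae⟩ := exists_subseq_ae_tendsto_of_tendsto_pi hz2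
  refine ⟨ms, ?_⟩
  -- A convergent sequence of parameters together with its limit is compact, so one constant bounds
  -- all truncated superpositions.
  obtain ⟨C, hC⟩ := exists_bound_clamp hΦ hM hz1.isCompact_insert_range
  refine (Lp.tendsto_Lp_iff_tendsto_eLpNorm''
    (fun n x => Φ (z (ns (ms n))).1 (clamp M fun i => (z (ns (ms n))).2 i x))
    (fun n => memLp_superposition_clamp hΦ hM _ _) _ (memLp_superposition_clamp hΦ hM a.1 a.2)).2 ?_
  refine tendsto_eLpNorm_sub_of_bounded hq0 hq (C := C)
    (fun n => (memLp_superposition_clamp (q := q) hΦ hM _ _).1)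
    (memLp_superposition_clamp (q := q) hΦ hM _ _).1
    (fun n => Eventually.of_forall fun x => hC _ (mem_insert_of_mem _ ⟨ms n, rfl⟩) _) ?_
  filter_upwards [hae] with x hx
  have h1 : Tendsto (fun n => clamp M fun i => (z (ns (ms n))).2 i x) atTop (𝓝 (clamp M fun i => a.2 i x)) :=
    ((continuous_clamp M).tendsto _).comp (tendsto_pi_nhds.2 hx)
  exact (hΦ.tendsto (a.1, clamp M fun i => a.2 i x)).comp
    ((hz1.comp hms.tendsto_atTop).prodMk_nhds h1)

end Superposition

/-! ### Passing to the limit in the differential equation. -/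

/-- Weak and strong limits in Bochner spaces agree. -/
theorem ae_eq_of_weakTendsto_of_tendsto_eLpNorm {α Z W : Type*} [MeasurableSpace α] {μ : Measure α}
    [IsFiniteMeasure μ] [NormedAddCommGroup Z] [NormedSpace ℝ Z] [CompleteSpace Z]
    [NormedAddCommGroup W] [NormedSpace ℝ W] [CompleteSpace W] {p : ℝ≥0∞} [Fact (1 ≤ p)]
    (B : Z →L[ℝ] W) {w : ℕ → Lp Z p μ} {w₀ : Lp Z p μ} (hw : WeakTendsto w w₀) {h : α → W}
    (hh : Integrable h μ)
    (hwh : Tendsto (fun n => eLpNorm (fun t => B (w n t) - h t) 1 μ) atTop (𝓝 0)) :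
    (fun t => B (w₀ t)) =ᵐ[μ] h := by
  have hi : ∀ f : Lp Z p μ, Integrable (fun t => B (f t)) μ := fun f =>
    B.integrable_comp ((Lp.memLp f).integrable Fact.out)
  refine (hi w₀).ae_eq_of_forall_setIntegral_eq _ _ hh fun A hA _ => ?_
  have hchi : MemLp (A.indicator fun _ => (1 : ℝ)) p.conjExponent μ :=
    memLp_indicator_const _ hA _ (Or.inr (measure_ne_top _ _))
  have hI : ∀ f : Lp Z p μ, B (weightedIntegral p Z hchi f) = ∫ t in A, B (f t) ∂μ := by
    intro f
    rw [weightedIntegral_apply]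
    have h1 : ∀ s, A.indicator (fun _ => (1 : ℝ)) s • f s = A.indicator f s := fun s => by
      by_cases hs : s ∈ A <;> simp [hs]
    simp_rw [h1]
    rw [integral_indicator hA, B.integral_comp_comm ((Lp.memLp f).integrable Fact.out).integrableOn]
  have h2 := (hw.map (weightedIntegral p Z hchi)).map B
  simp_rw [hI] at h2
  refine h2.unique (weakTendsto_of_tendsto ?_)
  exact tendsto_setIntegral_of_L1' h hh.aestronglyMeasurable (Eventually.of_forall fun n => hi (w n)) hwh A

namespace SpaceSetup

variable {d κ : ℕ} {Ω : Set (EuclideanSpace ℝ (Fin d))}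
  {ph qh : ℝ≥0∞} [Fact (1 ≤ ph)] [Fact (1 ≤ qh)]
  {V Vt W Y : Type*} {Vk : Fin κ → Type*}
  [NormedAddCommGroup V] [NormedSpace ℝ V] [NormedAddCommGroup Vt] [NormedSpace ℝ Vt]
  [NormedAddCommGroup W] [NormedSpace ℝ W] [NormedAddCommGroup Y] [NormedSpace ℝ Y]
  [∀ k, NormedAddCommGroup (Vk k)] [∀ k, NormedSpace ℝ (Vk k)]
  (S : SpaceSetup κ Ω ph qh V Vt W Y Vk)
  (A : Architecture) {τ : ℕ} (enc : Fin (A.width 0) ≃ Fin τ ⊕ MultiIdx d κ) {ε : ℝ}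

/-- The network as a function of the parameters, the time and the jet. -/
def jetEval (z : A.paramSet ε × ℝ) (ξ : MultiIdx d κ → ℝ) : ℝ :=
  A.eval z.1.1 fun j => Sum.elim (fun _ => z.2) ξ (enc j)

theorem continuous_jetEval (hε : 0 < ε) :
    Continuous fun z : (A.paramSet ε × ℝ) × (MultiIdx d κ → ℝ) => jetEval A enc z.1 z.2 := by
  refine (A.continuous_eval hε).comp (Continuous.prodMk (by fun_prop) (continuous_pi fun j => ?_))
  rcases enc j with i | β
  · exact continuous_snd.comp continuous_fst
  · exact (continuous_apply β).comp continuous_snd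

variable [IsFiniteMeasure (volume.restrict Ω)]

/-- The Nemytskii operator of the network, truncated to jets with entries in `[-M, M]`. -/
def truncNemytskii (hε : 0 < ε) {M : ℝ} (hM : 0 ≤ M)
    (z : (A.paramSet ε × ℝ) × (MultiIdx d κ → Lp ℝ ph (volume.restrict Ω))) : W :=
  S.lqToW ((memLp_superposition_clamp (continuous_jetEval A enc hε) hM z.1 z.2).toLp _)

theorem continuous_truncNemytskii (hqh : qh ≠ ⊤) (hε : 0 < ε) {M : ℝ} (hM : 0 ≤ M) :
    Continuous (S.truncNemytskii A enc hε hM) :=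
  S.lqToW.continuous.comp (continuous_superposition_clamp (continuous_jetEval A enc hε) hM hqh)

theorem exists_bound_truncNemytskii (hε : 0 < ε) {M : ℝ} (hM : 0 ≤ M) {s : Set (A.paramSet ε × ℝ)}
    (hs : IsCompact s) : ∃ C : ℝ, ∀ z ∈ s, ∀ f, ‖S.truncNemytskii A enc hε hM (z, f)‖ ≤ C := by
  obtain ⟨C, hC⟩ := exists_bound_clamp (continuous_jetEval A enc hε) hM hs
  refine ⟨‖S.lqToW‖ * ((volume.restrict Ω).real univ ^ qh.toReal⁻¹ * |C|), fun z hz f => ?_⟩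
  refine S.lqToW.le_opNorm_of_le ?_
  refine Lp.norm_le_of_ae_bound (abs_nonneg C) ?_
  filter_upwards [(memLp_superposition_clamp (q := qh) (continuous_jetEval A enc hε) hM z f).coeFn_toLp]
    with x hx
  rw [hx]
  exact (hC z hz _).trans (le_abs_self C)

/-- For bounded jets, the Nemytskii operator agrees with the truncated one. -/
theorem nemytskii_eq_truncNemytskii (hε : 0 < ε) {M : ℝ} (hM : 0 ≤ M) (θ : A.paramSet ε) (t : ℝ) (v : V)
    (hv : ∀ᵐ x ∂volume.restrict Ω, ∀ β, |S.jet v x β| ≤ M) :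
    MemLp (S.networkField A enc θ.1 t v) qh (volume.restrict Ω) ∧
      S.nemytskii A enc θ.1 t v = S.truncNemytskii A enc hε hM ((θ, t), (S.toSob v).1) := by
  have h0 := memLp_superposition_clamp (q := qh) (μ := volume.restrict Ω)
    (continuous_jetEval A enc hε) hM (θ, t) (S.toSob v).1
  have hae : (fun x => jetEval A enc (θ, t) (clamp M fun β => (S.toSob v).1 β x)) =ᵐ[volume.restrict Ω]
      S.networkField A enc θ.1 t v := by
    filter_upwards [hv] with x hx
    rw [clamp_eq_self (ξ := fun β => (S.toSob v).1 β x) hx]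
    rfl
  have h1 : MemLp (S.networkField A enc θ.1 t v) qh (volume.restrict Ω) := (memLp_congr_ae hae).1 h0
  refine ⟨h1, ?_⟩
  rw [nemytskii, dif_pos h1, truncNemytskii]
  congr 1
  exact MemLp.toLp_congr h1 h0 hae.symm

variable {T : ℝ} {p : ℝ≥0∞} [Fact (1 ≤ p)]

/-- Along a state with bounded jets, the Nemytskii operator agrees with the truncated one. -/
theorem ae_nemytskii_eq (hε : 0 < ε) {c : ℝ}
    (hreg : ∀ v : S.State T p, ∀ᵐ t ∂timeMeasure T, ∀ᵐ x ∂volume.restrict Ω,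
      ∀ β, |S.jet (StateSpace.state v t) x β| ≤ c * ‖v‖)
    {M : ℝ} (hM : 0 ≤ M) (u : S.State T p) (hu : c * ‖u‖ ≤ M) (θ : A.paramSet ε) :
    ∀ᵐ t ∂timeMeasure T, MemLp (S.networkField A enc θ.1 t (StateSpace.state u t)) qh (volume.restrict Ω) ∧
      S.nemytskii A enc θ.1 t (StateSpace.state u t) =
        S.truncNemytskii A enc hε hM ((θ, t), (S.toSob (StateSpace.state u t)).1) := by
  filter_upwards [hreg u] with t ht
  refine S.nemytskii_eq_truncNemytskii A enc hε hM θ t _ ?_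
  filter_upwards [ht] with x hx β
  exact (hx β).trans hu

theorem aestronglyMeasurable_truncNemytskii (hqh : qh ≠ ⊤) (hε : 0 < ε) {M : ℝ} (hM : 0 ≤ M)
    (u : S.State T p) (θ : A.paramSet ε) :
    AEStronglyMeasurable (fun t => S.truncNemytskii A enc hε hM
      ((θ, t), (S.toSob (StateSpace.state u t)).1)) (timeMeasure T) := by
  have h1 : AEStronglyMeasurable (fun t => S.toSob (StateSpace.state u t)) (timeMeasure T) :=
    S.toSob.continuous.comp_aestronglyMeasurable (Lp.aestronglyMeasurable _)
  have h2 : AEStronglyMeasurable (fun t => (S.toSob (StateSpace.state u t)).1) (timeMeasure T) :=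
    continuous_subtype_val.comp_aestronglyMeasurable h1
  have h3 : AEStronglyMeasurable (fun t : ℝ => (θ, t)) (timeMeasure T) :=
    (Continuous.prodMk_right θ).aestronglyMeasurable
  exact (S.continuous_truncNemytskii A enc hqh hε hM).comp_aestronglyMeasurable (h3.prodMk h2)

/-- Limits of almost solutions solve the limiting equation. -/
theorem solvesPDE_of_tendsto [CompleteSpace V] [CompleteSpace Vt] [CompleteSpace W] (hΩ : IsOpen Ω)
    (hqph : qh ≤ ph) (hph : ph ≠ ⊤) (hT : 0 < T) (hp1 : 1 < p) (hp : p ≠ ⊤) (hε : 0 < ε)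
    (hreg : S.UniformRegularity T p) {q : ℝ≥0∞} (hq1 : 1 ≤ q)
    {u : ℕ → S.State T p} {a : S.State T p} {R : ℝ} (hR : ∀ n, ‖u n‖ ≤ R) (hu : WeakTendsto u a)
    {θ : ℕ → A.paramSet ε} {θt : A.paramSet ε} (hθ : Tendsto θ atTop (𝓝 θt))
    (hres : Tendsto (fun n => eLpNorm (S.residual A enc (θ n).1 (u n)) q (timeMeasure T)) atTop (𝓝 0)) :
    S.SolvesPDE A enc θt.1 a := by
  have hqh : qh ≠ ⊤ := ne_top_of_le_ne_top hph hqph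
  obtain ⟨c, hc, hreg⟩ := hreg
  obtain ⟨φ, hφ, hae⟩ := S.exists_subseq_ae_tendsto_toSob hΩ hqph hT hp1 hp hR hu
  -- One truncation level for the jets of all `u n` and of the limit, so that truncation changes
  -- none of the operators involved.
  let M : ℝ := c * max R ‖a‖
  have hM : 0 ≤ M := by positivity
  have huM : ∀ n, c * ‖u n‖ ≤ M := fun n => by
    have := (hR n).trans (le_max_left R ‖a‖)
    exact mul_le_mul_of_nonneg_left this hc.le
  have haM : c * ‖a‖ ≤ M := by
    have := le_max_right R ‖a‖
    exact mul_le_mul_of_nonneg_left this hc.le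
  have heq := fun n => S.ae_nemytskii_eq A enc hε hreg hM (u (φ n)) (huM _) (θ (φ n))
  have heqa := S.ae_nemytskii_eq A enc hε hreg hM a haM θt
  let F : ℕ → ℝ → W := fun n t => S.truncNemytskii A enc hε hM
    ((θ (φ n), t), (S.toSob (StateSpace.state (u (φ n)) t)).1)
  let h : ℝ → W := fun t => S.truncNemytskii A enc hε hM ((θt, t), (S.toSob (StateSpace.state a t)).1)
  have hFm : ∀ n, AEStronglyMeasurable (F n) (timeMeasure T) := fun n =>
    S.aestronglyMeasurable_truncNemytskii A enc hqh hε hM _ _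
  have hhm : AEStronglyMeasurable h (timeMeasure T) :=
    S.aestronglyMeasurable_truncNemytskii A enc hqh hε hM _ _
  have hθφ : Tendsto (fun n => θ (φ n)) atTop (𝓝 θt) := hθ.comp hφ.tendsto_atTop
  obtain ⟨C, hC⟩ := S.exists_bound_truncNemytskii A enc hε hM
    (hθφ.isCompact_insert_range.prod (isCompact_Icc (a := (0 : ℝ)) (b := T)))
  have hFC : ∀ n, ∀ᵐ t ∂timeMeasure T, ‖F n t‖ ≤ C := fun n => by
    filter_upwards [ae_restrict_mem measurableSet_Ioo] with t ht
    exact hC (θ (φ n), t) ⟨mem_insert_of_mem _ ⟨n, rfl⟩, Ioo_subset_Icc_self ht⟩ _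
  have hhC : ∀ᵐ t ∂timeMeasure T, ‖h t‖ ≤ C := by
    filter_upwards [ae_restrict_mem measurableSet_Ioo] with t ht
    exact hC (θt, t) ⟨mem_insert _ _, Ioo_subset_Icc_self ht⟩ _
  have hFh : ∀ᵐ t ∂timeMeasure T, Tendsto (fun n => F n t) atTop (𝓝 (h t)) := by
    filter_upwards [hae] with t ht
    exact ((S.continuous_truncNemytskii A enc hqh hε hM).tendsto _).comp
      ((hθφ.prodMk_nhds tendsto_const_nhds).prodMk_nhds ((continuous_subtype_val.tendsto _).comp ht))
  have h1 := tendsto_eLpNorm_sub_of_bounded one_ne_zero ENNReal.one_ne_top hFm hhm hFC hFh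
  have hrF : ∀ n, S.residual A enc (θ (φ n)).1 (u (φ n)) =ᵐ[timeMeasure T]
      fun t => S.vtToW (StateSpace.timeDeriv (u (φ n)) t) - F n t := fun n => by
    filter_upwards [heq n] with t ht
    rw [residual, ht.2]
  have hdm : ∀ n, AEStronglyMeasurable (fun t => S.vtToW (StateSpace.timeDeriv (u (φ n)) t))
      (timeMeasure T) := fun n =>
    S.vtToW.continuous.comp_aestronglyMeasurable (Lp.aestronglyMeasurable _)
  -- On the finite time interval the `L^q` norm controls the `L^1` norm, and convergence in `L^1` is
  -- enough to identify limits.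
  have h2 : Tendsto (fun n => eLpNorm (fun t => S.vtToW (StateSpace.timeDeriv (u (φ n)) t) - F n t) 1
      (timeMeasure T)) atTop (𝓝 0) := by
    have h3 := ENNReal.Tendsto.mul_const (b := timeMeasure T univ ^ (1 / (1 : ℝ≥0∞).toReal - 1 / q.toReal))
      (hres.comp hφ.tendsto_atTop) (Or.inr ?_)
    · rw [zero_mul] at h3
      refine tendsto_of_tendsto_of_tendsto_of_le_of_le tendsto_const_nhds h3 (fun _ => zero_le) fun n => ?_
      simp only [Function.comp]
      rw [eLpNorm_congr_ae (hrF n)]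
      exact eLpNorm_le_eLpNorm_mul_rpow_measure_univ hq1 ((hdm n).sub (hFm n))
    · by_cases hq : q = ⊤
      · simp [hq]
      · refine ENNReal.rpow_ne_top_of_nonneg ?_ (measure_ne_top _ _)
        have : 1 ≤ q.toReal := by
          rw [← ENNReal.toReal_one]
          exact ENNReal.toReal_mono hq hq1
        rw [ENNReal.toReal_one, div_one, sub_nonneg, div_le_one (by linarith)]
        exact this
  have h4 : Tendsto (fun n => eLpNorm (fun t => S.vtToW (StateSpace.timeDeriv (u (φ n)) t) - h t) 1
      (timeMeasure T)) atTop (𝓝 0) := by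
    have h5 := h2.add h1
    rw [add_zero] at h5
    refine tendsto_of_tendsto_of_tendsto_of_le_of_le tendsto_const_nhds h5 (fun _ => zero_le) fun n => ?_
    refine le_trans (le_of_eq ?_) (eLpNorm_add_le ((hdm n).sub (hFm n)) ((hFm n).sub hhm) le_rfl)
    congr 1
    funext t
    simp
  -- The derivatives converge weakly to that of `a` and, after embedding in `W`, strongly to the
  -- network term; the two limits agree.
  have h6 := ae_eq_of_weakTendsto_of_tendsto_eLpNorm S.vtToW
    ((hu.comp hφ).map (StateSpace.timeDerivL (ι := S.toVt))) (h := h)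
    (Integrable.of_bound hhm C hhC) h4
  filter_upwards [h6, heqa] with t ht hat
  exact ⟨hat.1, ht.trans hat.2.symm⟩

end SpaceSetup

/-! ### Limits of the penalty terms, identification of weak limits and lower semicontinuity. -/

theorem tendsto_zero_of_rpow {α : Type*} {l : Filter α} {x : α → ℝ≥0∞} {s : ℝ} (hs : 0 < s)
    (h : Tendsto (fun n => x n ^ s) l (𝓝 0)) : Tendsto x l (𝓝 0) := by
  have h1 := (ENNReal.continuous_rpow_const (y := s⁻¹)).tendsto 0 |>.comp h
  simpa [Function.comp_def, ← ENNReal.rpow_mul, hs.ne', hs] using h1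

theorem liminf_add_liminf_le (x z : ℕ → ℝ≥0∞) :
    liminf x atTop + liminf z atTop ≤ liminf (fun n => x n + z n) atTop := by
  have hmono : ∀ w : ℕ → ℝ≥0∞, Monotone fun n => ⨅ i ≥ n, w i := fun w _ _ hmn =>
    le_iInf₂ fun i hi => iInf₂_le i (hmn.trans hi)
  simp only [liminf_eq_iSup_iInf_of_nat]
  rw [ENNReal.iSup_add_iSup_of_monotone (hmono x) (hmono z)]
  exact iSup_mono fun n => le_iInf₂ fun i hi => add_le_add (iInf₂_le i hi) (iInf₂_le i hi)

theorem tendsto_zero_of_ofReal_mul_le {α : Type*} {l : Filter α} {x : α → ℝ≥0∞} {w : α → ℝ}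
    (hw : Tendsto w l atTop) {C : ℝ≥0∞} (hC : C ≠ ⊤) (h : ∀ n, ENNReal.ofReal (w n) * x n ≤ C) :
    Tendsto x l (𝓝 0) := by
  have h1 : Tendsto (fun n => C / ENNReal.ofReal (w n)) l (𝓝 0) := by
    simpa using ENNReal.Tendsto.const_div (a := C) (ENNReal.tendsto_ofReal_atTop.comp hw) (Or.inr hC)
  refine tendsto_of_tendsto_of_tendsto_of_le_of_le' tendsto_const_nhds h1
    (Eventually.of_forall fun n => zero_le) ?_
  filter_upwards [hw.eventually_gt_atTop 0] with n hn
  rw [ENNReal.le_div_iff_mul_le (Or.inl (by simpa using hn)) (Or.inl ENNReal.ofReal_ne_top), mul_comm]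
  exact h n

/-- Uniqueness of weak subsequential limits of approximate solutions of `K u = K a`. -/
theorem weakLimit_unique_of_residual {X Z : Type*} [NormedAddCommGroup X] [NormedSpace ℝ X]
    [NormedAddCommGroup Z] {Kd : X → Z} (hinj : Function.Injective Kd) (hKd : WeakStrongContinuous Kd)
    {K : ℕ → X → Z} (hK : ∀ (v : ℕ → X) (a : X), WeakTendsto v a →
      Tendsto (fun m => K m (v m) - Kd (v m)) atTop (𝓝 0))
    {u : ℕ → X} {b : X} (hu : Tendsto (fun m => K m (u m) - K m b) atTop (𝓝 0))
    {φ : ℕ → ℕ} (hφ : StrictMono φ) {a : X} (ha : WeakTendsto (u ∘ φ) a) : a = b := by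
  classical
  -- The assumption on `K` concerns full sequences with matching indices. Filling the gaps of the
  -- subsequence with its limit `a` makes it applicable.
  let v : ℕ → X := fun m => if m ∈ range φ then u m else a
  have hv : WeakTendsto v a := by
    intro Λ
    rw [tendsto_atTop']
    intro s hs
    obtain ⟨n, hn⟩ := mem_atTop_sets.1 (ha Λ hs)
    refine ⟨φ n, fun m hm => ?_⟩
    by_cases h : m ∈ range φ
    · obtain ⟨k, rfl⟩ := h
      simpa [v] using hn k (hφ.le_iff_le.1 hm)
    · have : v m = a := if_neg h
      simpa [this] using mem_of_mem_nhds hs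
  have h1 := (hK v a hv).comp hφ.tendsto_atTop
  have h2 := (hK (fun _ => b) b (weakTendsto_of_tendsto tendsto_const_nhds)).comp hφ.tendsto_atTop
  have h3 := hu.comp hφ.tendsto_atTop
  -- `Kd u = (K u - K b) - (K u - Kd u) + (K b - Kd b) + Kd b`, and the first three terms vanish in
  -- the limit.
  have h4 : Tendsto (fun n => Kd (u (φ n))) atTop (𝓝 (Kd b)) := by
    have h5 := ((h3.sub h1).add h2).add_const (Kd b)
    simp only [sub_zero, zero_add, add_zero] at h5
    refine h5.congr fun n => ?_
    simp [v]
  exact hinj (tendsto_nhds_unique (hKd _ _ ha) h4)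

/-- A bounded sequence all of whose weak subsequential limits agree converges weakly. -/
theorem StateSpace.weakTendsto_of_forall_subseq {V Vt : Type*} [NormedAddCommGroup V] [NormedSpace ℝ V]
    [CompleteSpace V] [NormedAddCommGroup Vt] [NormedSpace ℝ Vt] [CompleteSpace Vt]
    [TopologicalSpace.SeparableSpace V] [TopologicalSpace.SeparableSpace Vt]
    {T : ℝ} {p : ℝ≥0∞} [Fact (1 ≤ p)] {ι : V →L[ℝ] Vt} (hV : IsReflexive V) (hVt : IsReflexive Vt)
    (hp1 : 1 < p) (hp : p ≠ ⊤) {u : ℕ → StateSpace T p ι} {M : ℝ} (hu : ∀ n, ‖u n‖ ≤ M)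
    {b : StateSpace T p ι}
    (h : ∀ (φ : ℕ → ℕ) (a : StateSpace T p ι), StrictMono φ → WeakTendsto (u ∘ φ) a → a = b) :
    WeakTendsto u b := by
  intro Λ
  refine tendsto_of_subseq_tendsto fun ns hns => ?_
  obtain ⟨φ, hφ, hφ'⟩ := strictMono_subseq_of_tendsto_atTop hns
  obtain ⟨a, ψ, hψ, ha⟩ := exists_weakTendsto_subseq hV hVt hp1 hp (u ∘ ns ∘ φ) fun n => hu _
  obtain rfl := h _ a (hφ'.comp hψ) ha
  exact ⟨φ ∘ ψ, ha Λ⟩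

namespace SpaceSetup

variable {d κ : ℕ} {Ω : Set (EuclideanSpace ℝ (Fin d))}
  {ph qh : ℝ≥0∞} [Fact (1 ≤ ph)] [Fact (1 ≤ qh)]
  {V Vt W Y : Type*} {Vk : Fin κ → Type*}
  [NormedAddCommGroup V] [NormedSpace ℝ V] [NormedAddCommGroup Vt] [NormedSpace ℝ Vt]
  [NormedAddCommGroup W] [NormedSpace ℝ W] [NormedAddCommGroup Y] [NormedSpace ℝ Y]
  [∀ k, NormedAddCommGroup (Vk k)] [∀ k, NormedSpace ℝ (Vk k)]
  (S : SpaceSetup κ Ω ph qh V Vt W Y Vk)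
  (A : Architecture) {τ : ℕ} (enc : Fin (A.width 0) ≃ Fin τ ⊕ MultiIdx d κ)
  {T : ℝ} {p : ℝ≥0∞} [Fact (1 ≤ p)]

variable {S A enc} in
theorem SolvesPDE.eLpNorm_residual {θ : A.Coeffs} {u : S.State T p} (h : S.SolvesPDE A enc θ u)
    (q : ℝ≥0∞) : eLpNorm (S.residual A enc θ u) q (timeMeasure T) = 0 := by
  refine eLpNorm_eq_zero_of_ae_zero ?_
  filter_upwards [h] with t ht
  exact sub_eq_zero.2 ht.2

variable {S A enc} in
theorem SolvesPDE.objective_le {q r : ℝ≥0∞} [Fact (1 ≤ r)] (hq : 0 < q.toReal)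
    {N : Seminorm ℝ (S.State T p)}
    {Θ : Set A.Coeffs} {R₀ : Θ → ℝ≥0∞} {lam mu δ : ℝ} (hmu : 0 ≤ mu)
    {K : S.State T p → Lp Y r (timeMeasure T)} {y : Lp Y r (timeMeasure T)} {u : S.State T p}
    (hy : ‖y - K u‖ ^ r.toReal ≤ δ) {θ : Θ} (h : S.SolvesPDE A enc θ.1 u) :
    S.objective A enc q N R₀ lam mu K y u θ ≤
      ENNReal.ofReal (mu * δ) + S.regularization A N R₀ u θ := by
  rw [objective, h.eLpNorm_residual, ENNReal.zero_rpow_of_pos hq, mul_zero, zero_add, norm_sub_rev]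
  gcongr

/-- Passing to the limit in the comparison of regularization terms. -/
theorem regularization_le_of_tendsto {N : Seminorm ℝ (S.State T p)} (hN : IsEquivalentNorm N)
    {Θ : Set A.Coeffs} {R₀ : Θ → ℝ≥0∞} (hR₀ : LowerSemicontinuous R₀) (hp : 0 < p.toReal)
    {u : ℕ → S.State T p} {a : S.State T p} (hu : WeakTendsto u a)
    {θ : ℕ → Θ} {θt : Θ} (hθ : Tendsto θ atTop (𝓝 θt)) {e : ℕ → ℝ≥0∞} (he : Tendsto e atTop (𝓝 0))
    {B : ℝ≥0∞} (h : ∀ n, S.regularization A N R₀ (u n) (θ n) ≤ e n + B) :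
    S.regularization A N R₀ a θt ≤ B := by
  have hB : Tendsto (fun n => e n + B) atTop (𝓝 B) := by simpa using he.add_const B
  have hNa : ENNReal.ofReal (N a ^ p.toReal) ≤
      liminf (fun n => ENNReal.ofReal (N (u n) ^ p.toReal)) atTop := by
    refine le_of_forall_lt_imp_le_of_dense fun c hc => le_liminf_of_le (by isBoundedDefault) ?_
    -- Taking `p`-th roots reduces a lower bound on the power to one on `N`, where weak lower
    -- semicontinuity is available.
    have hlt : ∀ v, c < ENNReal.ofReal (N v ^ p.toReal) ↔ c ^ p.toReal⁻¹ < ENNReal.ofReal (N v) := fun v => by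
      rw [ENNReal.rpow_inv_lt_iff hp, ENNReal.ofReal_rpow_of_nonneg (apply_nonneg N v) hp.le]
    have hc' := (hlt a).1 hc
    have htop := hc'.ne_top
    rw [ENNReal.lt_ofReal_iff_toReal_lt htop] at hc'
    filter_upwards [hN.eventually_lt hu hc'] with n hn
    exact ((hlt _).2 ((ENNReal.lt_ofReal_iff_toReal_lt htop).2 hn)).le
  have hRt : R₀ θt ≤ liminf (fun n => R₀ (θ n)) atTop := by
    refine le_of_forall_lt_imp_le_of_dense fun c hc => le_liminf_of_le (by isBoundedDefault) ?_
    filter_upwards [hθ.eventually (hR₀ θt c hc)] with n hn using hn.le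
  calc S.regularization A N R₀ a θt
      ≤ liminf (fun n => ENNReal.ofReal (N (u n) ^ p.toReal)) atTop + liminf (fun n => R₀ (θ n)) atTop :=
        add_le_add hNa hRt
    _ ≤ liminf (fun n => S.regularization A N R₀ (u n) (θ n)) atTop :=
        liminf_add_liminf_le _ _
    _ ≤ liminf (fun n => e n + B) atTop := liminf_le_liminf (Eventually.of_forall h)
    _ = B := hB.liminf_eq

end SpaceSetup

end SymNet

end

/-! ### Convergence of the minimizers. -/

theorem theorem3p6
    -- domain, time horizon, exponents
    {d κ : ℕ} {Ω : Set (EuclideanSpace ℝ (Fin d))} (hΩ : IsBoundedLipschitzDomain Ω)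
    {T : ℝ} (hT : 0 < T)
    {p q r ph qh : ℝ≥0∞} [Fact (1 ≤ p)] [Fact (1 ≤ q)] [Fact (1 ≤ r)] [Fact (1 ≤ ph)]
    [Fact (1 ≤ qh)] (hp : 1 < p) (hp_fin : p ≠ ⊤) (hqp : q ≤ p) (hr_fin : r ≠ ⊤)
    (hqph : qh ≤ ph) (hph_fin : ph ≠ ⊤)
    -- static Banach spaces and their embeddings
    {V Vt W Y : Type*} {Vk : Fin κ → Type*}
    [NormedAddCommGroup V] [NormedSpace ℝ V] [CompleteSpace V]
    [NormedAddCommGroup Vt] [NormedSpace ℝ Vt] [CompleteSpace Vt]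
    [NormedAddCommGroup W] [NormedSpace ℝ W] [CompleteSpace W]
    [NormedAddCommGroup Y] [NormedSpace ℝ Y] [CompleteSpace Y]
    [∀ k, NormedAddCommGroup (Vk k)] [∀ k, NormedSpace ℝ (Vk k)] [∀ k, CompleteSpace (Vk k)]
    (S : SpaceSetup κ Ω ph qh V Vt W Y Vk)
    -- uniform state space regularity, norm of the dynamic state space
    (hreg : S.UniformRegularity T p)
    (N : Seminorm ℝ (S.State T p)) (hN : IsEquivalentNorm N)
    -- symbolic network (`τ = 1`: time is an input, `τ = 0`: it is not) and its parameter set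
    (A : Architecture) {τ : ℕ} (hτ : τ ≤ 1) (enc : Fin (A.width 0) ≃ Fin τ ⊕ MultiIdx d κ)
    {ε : ℝ} (hε : 0 < ε)
    -- measurement operators
    (Kd : S.State T p → Lp Y r (timeMeasure T)) (hKd_inj : Function.Injective Kd)
    (hKd : WeakStrongContinuous Kd)
    (K : ℕ → S.State T p → Lp Y r (timeMeasure T)) (hK : ∀ m, WeakWeakContinuous (K m))
    (hKconv : ∀ (v : ℕ → S.State T p) (a : S.State T p), WeakTendsto v a →
      Tendsto (fun m => K m (v m) - Kd (v m)) atTop (𝓝 0))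
    -- regularization of the parameters
    (R₀ : A.paramSet ε → ℝ≥0∞) (hR₀ : IsRegularizer R₀)
    -- admissible solution, representable by the network with finite regularization
    (ud : S.State T p) (yd : Lp Y r (timeMeasure T)) (hyd : Kd ud = yd)
    (hrep : ∃ θd : A.paramSet ε, S.SolvesPDE A enc θd.1 ud ∧ R₀ θd ≠ ⊤)
    -- noisy data
    (y : ℕ → Lp Y r (timeMeasure T)) (δ : ℕ → ℝ) (hδ0 : ∀ m, 0 ≤ δ m)
    (hδ : Tendsto δ atTop (𝓝 0)) (hnoise : ∀ m, ‖y m - K m ud‖ ^ r.toReal ≤ δ m)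
    -- weights
    (lam mu : ℕ → ℝ) (hlam_pos : ∀ m, 0 < lam m) (hmu_pos : ∀ m, 0 < mu m)
    (hlam : Tendsto lam atTop atTop) (hmu : Tendsto mu atTop atTop)
    (hmuδ : Tendsto (fun m => mu m * δ m) atTop (𝓝 0))
    -- minimizers of the all-at-once functionals
    (u : ℕ → S.State T p) (θ : ℕ → A.paramSet ε)
    (hmin : ∀ m (v : S.State T p) (η : A.paramSet ε),
      S.objective A enc q N R₀ (lam m) (mu m) (K m) (y m) (u m) (θ m) ≤
        S.objective A enc q N R₀ (lam m) (mu m) (K m) (y m) v η) :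
    WeakTendsto u ud ∧
    (∃ (ns : ℕ → ℕ) (θt : A.paramSet ε), StrictMono ns ∧
      Tendsto (fun l => θ (ns l)) atTop (𝓝 θt)) ∧
    ∀ (ns : ℕ → ℕ) (θt : A.paramSet ε), StrictMono ns →
      Tendsto (fun l => θ (ns l)) atTop (𝓝 θt) →
      S.SolvesPDE A enc θt.1 ud ∧
      (∀ B : Set (Fin (A.width 0) → ℝ), IsCompact B →
        Tendsto (fun l => eLpNorm (fun x => A.eval (θ (ns l)).1 x - A.eval θt.1 x) ⊤
          (volume.restrict B)) atTop (𝓝 0)) ∧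
      ∀ η : A.paramSet ε, S.SolvesPDE A enc η.1 ud →
        S.regularization A N R₀ ud θt ≤ S.regularization A N R₀ ud η := by
  have := S.separable_V
  have := S.separable_Vt
  have : IsFiniteMeasure (volume.restrict Ω) :=
    isFiniteMeasure_restrict.2 hΩ.isBounded.measure_lt_top.ne
  have hq1 : 1 ≤ q := Fact.out
  have hr1 : 1 ≤ r := Fact.out
  have hP : 0 < p.toReal := ENNReal.toReal_pos (zero_lt_one.trans hp).ne' hp_fin
  have hQ : 0 < q.toReal :=
    ENNReal.toReal_pos (zero_lt_one.trans_le hq1).ne' (ne_top_of_le_ne_top hp_fin hqp)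
  have hr : 0 < r.toReal := ENNReal.toReal_pos (zero_lt_one.trans_le hr1).ne' hr_fin
  -- Every exact law `η` is a competitor together with `ud`; the same estimate serves for
  -- boundedness and, at the end, for optimality.
  have hcomp : ∀ (η : A.paramSet ε), S.SolvesPDE A enc η.1 ud → ∀ m,
      S.objective A enc q N R₀ (lam m) (mu m) (K m) (y m) (u m) (θ m) ≤
        ENNReal.ofReal (mu m * δ m) + S.regularization A N R₀ ud η := fun η hη m =>
    (hmin m ud η).trans (hη.objective_le hQ (hmu_pos m).le (hnoise m))
  have hreg_le : ∀ (η : A.paramSet ε), S.SolvesPDE A enc η.1 ud → ∀ m,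
      S.regularization A N R₀ (u m) (θ m) ≤
        ENNReal.ofReal (mu m * δ m) + S.regularization A N R₀ ud η := fun η hη m =>
    le_add_self.trans (hcomp η hη m)
  obtain ⟨θd, hθd, hθd_fin⟩ := hrep
  obtain ⟨C, hC, hCobj⟩ : ∃ C : ℝ≥0∞, C ≠ ⊤ ∧
      ∀ m, S.objective A enc q N R₀ (lam m) (mu m) (K m) (y m) (u m) (θ m) ≤ C := by
    -- A convergent real sequence is bounded, which makes `C` independent of `m`.
    obtain ⟨b, hb⟩ := hmuδ.bddAbove_range
    refine ⟨ENNReal.ofReal b + S.regularization A N R₀ ud θd, ?_, fun m => (hcomp θd hθd m).trans ?_⟩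
    · exact ENNReal.add_ne_top.2 ⟨ENNReal.ofReal_ne_top, ENNReal.add_ne_top.2 ⟨ENNReal.ofReal_ne_top, hθd_fin⟩⟩
    · gcongr
      exact hb ⟨m, rfl⟩
  have hCreg : ∀ m, S.regularization A N R₀ (u m) (θ m) ≤ C := fun m => le_add_self.trans (hCobj m)
  -- boundedness of the states
  obtain ⟨R, hR⟩ : ∃ R : ℝ, ∀ m, ‖u m‖ ≤ R := by
    obtain ⟨c, _, hc, _, hcN⟩ := hN
    refine ⟨C.toReal ^ p.toReal⁻¹ / c, fun m => ?_⟩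
    have h1 : ENNReal.ofReal (N (u m) ^ p.toReal) ≤ C := le_self_add.trans (hCreg m)
    have h2 := (ENNReal.ofReal_le_iff_le_toReal hC).1 h1
    rw [le_div_iff₀ hc, mul_comm]
    exact (hcN _).1.trans ((Real.le_rpow_inv_iff_of_pos (apply_nonneg N _) ENNReal.toReal_nonneg hP).2 h2)
  -- vanishing residuals
  have hres : Tendsto (fun m => eLpNorm (S.residual A enc (θ m).1 (u m)) q (timeMeasure T)) atTop (𝓝 0) :=
    tendsto_zero_of_rpow hQ (tendsto_zero_of_ofReal_mul_le hlam hC fun m =>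
      (le_self_add.trans le_self_add).trans (hCobj m))
  have hdata : Tendsto (fun m => K m (u m) - y m) atTop (𝓝 0) := by
    rw [tendsto_zero_iff_enorm_tendsto_zero]
    refine tendsto_zero_of_rpow hr (tendsto_zero_of_ofReal_mul_le hmu hC fun m => ?_)
    have h1 := (le_add_self.trans le_self_add).trans (hCobj m)
    rwa [ENNReal.ofReal_mul (hmu_pos m).le, ← ENNReal.ofReal_rpow_of_nonneg (norm_nonneg _) hr.le,
      ofReal_norm] at h1
  have hnoise0 : Tendsto (fun m => y m - K m ud) atTop (𝓝 0) := by
    rw [tendsto_zero_iff_enorm_tendsto_zero]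
    refine tendsto_zero_of_rpow hr ?_
    have h1 : Tendsto (fun m => ENNReal.ofReal (δ m)) atTop (𝓝 0) := by
      simpa using ENNReal.tendsto_ofReal hδ
    refine tendsto_of_tendsto_of_tendsto_of_le_of_le tendsto_const_nhds h1 (fun m => zero_le) fun m => ?_
    rw [← ofReal_norm, ENNReal.ofReal_rpow_of_nonneg (norm_nonneg _) hr.le]
    exact ENNReal.ofReal_le_ofReal (hnoise m)
  -- The misfit and the noise add up to the difference between the measurements of `u m` and of
  -- `ud`.
  have hKu : Tendsto (fun m => K m (u m) - K m ud) atTop (𝓝 0) := by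
    simpa using hdata.add hnoise0
  have hweak : WeakTendsto u ud :=
    StateSpace.weakTendsto_of_forall_subseq S.reflexive_V S.reflexive_Vt hp hp_fin hR
      fun φ a hφ ha => weakLimit_unique_of_residual hKd_inj hKd hKconv hKu hφ ha
  refine ⟨hweak, A.exists_tendsto_subseq_of_bounded (hR₀.isBounded_sublevel hC)
    fun m => le_add_self.trans (hCreg m), fun ns θt hns hθt => ⟨?_, ?_, ?_⟩⟩
  · exact S.solvesPDE_of_tendsto A enc hΩ.isOpen hqph hph_fin hT hp hp_fin hε hreg hq1
      (fun n => hR (ns n)) (hweak.comp hns) hθt (hres.comp hns.tendsto_atTop)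
  · exact fun B hB => A.tendsto_eLpNorm_top_restrict hε hθt hB
  · intro η hη
    have he : Tendsto (fun m => ENNReal.ofReal (mu m * δ m)) atTop (𝓝 0) := by
      simpa using ENNReal.tendsto_ofReal hmuδ
    exact S.regularization_le_of_tendsto A hN hR₀.lsc hP (hweak.comp hns) hθt
      (he.comp hns.tendsto_atTop) fun n => hreg_le η hη (ns n)
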